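/- Let $(Y,\bullet)$ be a path-connected, well-pointed topological space; here well-pointed means that $(Y,\{\bullet\})$ is an NDR pair (equivalently, that the inclusion of $\bullet$ is a closed cofibration): there are a continuous $w\colon Y\to[0,1]$ with $w^{-1}(0)=\{\bullet\}$ and a homotopy $h\colon Y\times[0,1]\to Y$ with $h(y,0)=y$ and $h(\bullet,t)=\bullet$ for all $y,t$, and $h(y,1)=\bullet$ whenever $w(y)<1$. Let $G=\pi_1(Y,\bullet)$ and let $n\ge 1$. A $Y$-tree is a rooted tree with vertex set $\{1,\dots,n\}$, with edges directed away from the root, and with each edge labelled by a point of $Y$. The $Y$-trees form a space, namely the disjoint union of the products $Y^{E(T)}$ over all rooted trees $T$ with vertex set $\{1,\dots,n\}$. If an edge $i\to j$ of a $Y$-tree $T$ is labelled by $\bullet$ and $i$ is not the root, let $k\to i$ be the edge coming into $i$ and let $y$ be its label; write $T_{ij}$ for the $Y$-tree obtained from $T$ by removing the edge $i\to j$ and adding the edge $k\to j$ with label $y$. The space $\mathrm{BCact}_Y(n)$ of based $Y$-cacti is the quotient of the space of $Y$-trees by the equivalence relation generated by $T\sim T_{ij}$ for all such $T$ and $i\to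 j$, and $\mathrm{BCact}_Y(n)_1$ is the subspace of (classes of) trees with root $1$. Its base point is the corolla with root $1$ and all labels equal to $\bullet$. Then $\mathrm{BCact}_Y(n)_1$ is path connected. Further, for $i\in\{1,\dots,n\}$, $j\in\{2,\dots,n\}$ with $i\ne j$ and $g\in G$, let $\alpha^g_{ij}\in\pi_1(\mathrm{BCact}_Y(n)_1)$ be the image of $g$ under the map induced by $Y\to\mathrm{BCact}_Y(n)_1$ that sends $y$ to the tree with root $1$, with the edge $i\to j$ labelled by $y$, and with edges $1\to k$ labelled by $\bullet$ for all $k\ne 1,j$. Then the group $\pi_1(\mathrm{BCact}_Y(n)_1)$ is presented by the generators $\alpha^g_{ij}$ ($1\le i\le n$, $2\le j\le n$, $i\neq j$, $g\in G$) and the following relations, for all $g,h\in G$ and all indices for which the generators involved are defined: $$\alpha^g_{ij}\alpha^h_{ij}=\alpha^{gh}_{ij};$$ $$[\alpha^g_{ij},\alpha^h_{ik}]=e\quad\text{for distinct } i,j,k;$$ $$[\alpha^g_{ij},\alpha^h_{kl}]=e\quad\text{for distinct } i,j,k,l;$$ $$[\alpha^g_{ij}\alpha^g_{ik},\alpha^h_{jk}]=e\quad\text{for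 distinct } i,j,k.$$ -/

import Mathlib

universe u v

namespace BasedCacti

/-! ### Rooted trees -/

/-- A rooted tree with vertex set `V`. Orienting the edges away from the root, every vertex
`j ≠ root` has exactly one incoming edge `parent j ⟶ j`, and following the incoming edges backwards
from any vertex one reaches the root. So the edges are exactly the pairs `(parent j, j)` with
`j ≠ root`; the value `parent root = root` is a normalisation, so that two rooted trees are equal as
soon as they have the same root and the same edges. -/
@[ext]
structure RootedTree (V : Type u) where
  root : V
  parent : V → V
  parent_root : parent root = root
  reaches_root : ∀ v, ∃ k : ℕ, parent^[k] v = root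

namespace RootedTree

variable {V : Type u}

/-- The edges of a rooted tree, each named by its end vertex: `j` stands for the directed edge
`parent j ⟶ j`. -/
abbrev Edge (T : RootedTree V) : Type u := {j : V // j ≠ T.root}

/-- For an edge `i ⟶ j` of `T`, where `i = T.parent j`, the tree obtained by removing `i ⟶ j`
and adding `k ⟶ j`, where `k ⟶ i` is the incoming edge of `i`. -/
def cut [DecidableEq V] (T : RootedTree V) (j : V) (hj : j ≠ T.root) : RootedTree V where
  root := T.root
  parent := Function.update T.parent j (T.parent (T.parent j))
  parent_root := by
    rw [Function.update_of_ne (Ne.symm hj)]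
    exact T.parent_root
  reaches_root := by
    have key : ∀ k : ℕ, ∀ v, T.parent^[k] v = T.root →
        ∃ m : ℕ, (Function.update T.parent j (T.parent (T.parent j)))^[m] v = T.root := by
      intro k
      induction k using Nat.strong_induction_on with
      | _ k ih =>
        intro v hv
        match k, ih, hv with
        | 0, _, hv => exact ⟨0, hv⟩
        | k + 1, ih, hv =>
          by_cases hvj : v = j
          · subst hvj
            match k, ih, hv with
            | 0, _, hv =>
              refine ⟨1, ?_⟩
              have h1 : T.parent v = T.root := by simpa using hv
              simp [h1, T.parent_root]
            | k + 1, ih, hv =>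
              obtain ⟨m, hm⟩ := ih k (by omega) (T.parent (T.parent v)) (by simpa using hv)
              exact ⟨m + 1, by simpa using hm⟩
          · obtain ⟨m, hm⟩ := ih k (by omega) (T.parent v) (by simpa using hv)
            refine ⟨m + 1, ?_⟩
            rw [Function.iterate_succ_apply, Function.update_of_ne hvj]
            exact hm
    intro v
    obtain ⟨k, hk⟩ := T.reaches_root v
    exact key k v hk

/-- The corolla with root `r`: its edges are `r ⟶ k` for all `k ≠ r`. -/
def corolla (r : V) : RootedTree V where
  root := r
  parent := fun _ => r
  parent_root := rfl
  reaches_root := fun _ => ⟨1, rfl⟩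

/-- The tree with root `r`, the edge `i ⟶ j`, and the edges `r ⟶ k` for all `k ≠ r, j`
(which is the corolla if `i = r`). -/
def branch [DecidableEq V] (r i j : V) (hij : i ≠ j) (hj : j ≠ r) : RootedTree V where
  root := r
  parent := fun k => if k = j then i else r
  parent_root := if_neg (Ne.symm hj)
  reaches_root := by
    intro k
    refine ⟨2, ?_⟩
    by_cases hk : k = j
    · simp [hk, hij]
    · simp [hk, Ne.symm hj]

end RootedTree

/-! ### Labelled trees and the space of based cacti -/

/-- The space of `Y`-trees with vertex set `V`: rooted trees whose edges carry labels in `Y`. It is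
the disjoint union, over all rooted trees, of the product spaces `Y ^ E(T)`. -/
abbrev LabelledTree (V : Type u) (Y : Type v) : Type (max u v) :=
  Σ T : RootedTree V, (T.Edge → Y)

section Spaces

variable {V : Type u} [DecidableEq V] {Y : Type v}

/-- The relation `T ↦ T_{ij}`. Let `i ⟶ j` be an edge of `T` such that `i` is not the root and
such that the label of `i ⟶ j` is the base point. Then `T_{ij}` is obtained by removing `i ⟶ j` and
adding the edge `k ⟶ j` with the label of the edge `k ⟶ i`. All other edges keep their labels. -/
inductive IsReduction (y₀ : Y) : LabelledTree V Y → LabelledTree V Y → Prop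
  | mk (T : RootedTree V) (l : T.Edge → Y) (j : V) (hj : j ≠ T.root)
      (hi : T.parent j ≠ T.root) (hl : l ⟨j, hj⟩ = y₀) :
      IsReduction y₀ ⟨T, l⟩
        ⟨T.cut j hj, fun e => if e.1 = j then l ⟨T.parent j, hi⟩ else l e⟩

/-- The space of based cacti: the quotient of the space of labelled trees by the equivalence
relation generated by reductions, with the quotient topology. -/
def BCact (V : Type u) [DecidableEq V] {Y : Type v} (y₀ : Y) : Type (max u v) :=
  Quot (IsReduction (V := V) y₀)

instance [TopologicalSpace Y] (y₀ : Y) : TopologicalSpace (BCact V y₀) :=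
  inferInstanceAs (TopologicalSpace (Quot (IsReduction (V := V) y₀)))

/-- The root of a based cactus. -/
def BCact.root {y₀ : Y} : BCact V y₀ → V :=
  Quot.lift (fun x => x.1.root) (by rintro _ _ ⟨⟩; rfl)

/-- The subspace of based cacti with root `r`. -/
def BCactRoot (y₀ : Y) (r : V) : Type (max u v) :=
  {x : BCact V y₀ // x.root = r}

instance [TopologicalSpace Y] (y₀ : Y) (r : V) : TopologicalSpace (BCactRoot y₀ r) :=
  inferInstanceAs (TopologicalSpace {x : BCact V y₀ // x.root = r})

/-- The base point: the corolla with root `r` and all edges labelled by the base point. -/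
def BCactRoot.base (y₀ : Y) (r : V) : BCactRoot y₀ r :=
  ⟨Quot.mk _ ⟨RootedTree.corolla r, fun _ => y₀⟩, rfl⟩

/-- The map sending `y` to the tree with root `r`, the edge `i ⟶ j` labelled by `y`, and the
edges `r ⟶ k`, for `k ≠ r, j`, labelled by the base point. -/
def branchMap [TopologicalSpace Y] (y₀ : Y) (r i j : V) (hij : i ≠ j) (hj : j ≠ r) :
    C(Y, BCactRoot y₀ r) where
  toFun y := ⟨Quot.mk _ ⟨RootedTree.branch r i j hij hj, fun e => if e.1 = j then y else y₀⟩, rfl⟩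
  continuous_toFun := by
    refine Continuous.subtype_mk (continuous_quot_mk.comp (continuous_sigmaMk.comp ?_)) _
    refine continuous_pi fun e => ?_
    by_cases h : e.1 = j
    · simp only [h, if_true]
      exact continuous_id
    · simp only [h, if_false]
      exact continuous_const

theorem branchMap_base [TopologicalSpace Y] (y₀ : Y) (r i j : V) (hij : i ≠ j) (hj : j ≠ r) :
    branchMap y₀ r i j hij hj y₀ = BCactRoot.base y₀ r := by
  have aux : ∀ (T S : RootedTree V), T = S →
      (⟨T, fun _ => y₀⟩ : LabelledTree V Y) = ⟨S, fun _ => y₀⟩ := by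
    rintro T _ rfl; rfl
  apply Subtype.ext
  change Quot.mk _ _ = Quot.mk _ _
  simp only [ite_self]
  by_cases hir : i = r
  · congr 1
    apply aux
    subst hir
    ext <;> simp [RootedTree.branch, RootedTree.corolla]
  · have hp : (RootedTree.branch r i j hij hj).parent j = i := by simp [RootedTree.branch]
    refine (Quot.sound (IsReduction.mk (RootedTree.branch r i j hij hj) (fun _ => y₀) j hj
      (by rw [hp]; exact hir) rfl)).trans ?_
    simp only [ite_self]
    congr 1
    apply aux
    ext k
    · rfl
    · by_cases hk : k = j
      · subst hk
        simp [RootedTree.branch, RootedTree.corolla, RootedTree.cut, hij]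
      · simp [RootedTree.branch, RootedTree.corolla, RootedTree.cut, hk]

/-- The element `α_{ij}^g` of the fundamental group: the class of the loop which labels the edge
`i ⟶ j` of the tree of `branchMap` by a loop in the class `g`. -/
noncomputable def alpha [TopologicalSpace Y] (y₀ : Y) (r i j : V) (hij : i ≠ j) (hj : j ≠ r)
    (g : FundamentalGroup Y y₀) : FundamentalGroup (BCactRoot y₀ r) (BCactRoot.base y₀ r) :=
  FundamentalGroup.mapOfEq (branchMap y₀ r i j hij hj) (branchMap_base y₀ r i j hij hj) g

end Spaces

/-! ### The presentation -/

section Presentation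

open scoped commutatorElement

variable {V : Type u}

/-- The symbols `α_{ij}^g` with `i ≠ j` and `j ≠ r`. -/
structure Gen (r : V) (G : Type v) where
  src : V
  tgt : V
  src_ne_tgt : src ≠ tgt
  tgt_ne_root : tgt ≠ r
  label : G

/-- The symbol `α_{ij}^g` as an element of the free group. -/
def gen {r : V} {G : Type v} (i j : V) (hij : i ≠ j) (hj : j ≠ r) (g : G) : FreeGroup (Gen r G) :=
  FreeGroup.of ⟨i, j, hij, hj, g⟩

/-- The relators. -/
inductive IsRelator (r : V) (G : Type v) [Group G] : FreeGroup (Gen r G) → Prop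
  | mul (i j : V) (hij : i ≠ j) (hj : j ≠ r) (g h : G) :
      IsRelator r G (gen i j hij hj g * gen i j hij hj h * (gen i j hij hj (g * h))⁻¹)
  | comm_same (i j k : V) (hij : i ≠ j) (hik : i ≠ k) (_ : j ≠ k) (hj : j ≠ r) (hk : k ≠ r)
      (g h : G) :
      IsRelator r G ⁅gen i j hij hj g, gen i k hik hk h⁆
  | comm_disjoint (i j k l : V) (hij : i ≠ j) (_ : i ≠ k) (_ : i ≠ l) (_ : j ≠ k) (_ : j ≠ l)
      (hkl : k ≠ l) (hj : j ≠ r) (hl : l ≠ r) (g h : G) :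
      IsRelator r G ⁅gen i j hij hj g, gen k l hkl hl h⁆
  | comm_triple (i j k : V) (hij : i ≠ j) (hik : i ≠ k) (hjk : j ≠ k) (hj : j ≠ r) (hk : k ≠ r)
      (g h : G) :
      IsRelator r G ⁅gen i j hij hj g * gen i k hik hk g, gen j k hjk hk h⁆

/-- The group with generators `α_{ij}^g` and the relations above. -/
abbrev CactusGroup (r : V) (G : Type v) [Group G] : Type (max u v) :=
  PresentedGroup {w | IsRelator r G w}

end Presentation

/-! ### Well-pointed spaces -/

/-- The base point is nondegenerate: `({y₀} ⊆ Y)` is an NDR pair, that is, there are a continuous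
`w : Y → [0, 1]` with `w ⁻¹(0) = {y₀}` and a homotopy `h : Y × [0, 1] → Y` relative to `y₀` that
starts at the identity and ends at a map sending `{w < 1}` to `y₀`. Equivalently, the inclusion of
the base point is a closed cofibration. -/
def WellPointed {Y : Type v} [TopologicalSpace Y] (y₀ : Y) : Prop :=
  ∃ (w : C(Y, unitInterval)) (h : C(Y × unitInterval, Y)),
    (∀ y, w y = 0 ↔ y = y₀) ∧ (∀ y, h (y, 0) = y) ∧ (∀ t, h (y₀, t) = y₀) ∧
      ∀ y, w y < 1 → h (y, 1) = y₀

end BasedCacti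

/-! A based cactus has coordinates: for vertices i and k, the label of the edge leaving i towards k,
or the base point if i is not a proper ancestor of k. Reductions preserve them
(`treeCoord_reduction`), they are continuous, and for a fixed root they determine the cactus
(`BCactRoot.ext`), because in a reduced tree the nontrivial coordinates with i not the root record
the ancestor relation. So equality of loops of cacti can be checked coordinatewise.

The relations hold because loops that move different edge labels of one tree T come from commuting
factors of G^E(T). In the tree i → j → k, moving the label of i → j changes the coordinates (i, j)
and (i, k) together, which is the element α_ij^g α_ik^g; this is the source of the last relation.
Hence there is a homomorphism `cactusHom` from the presented group.

Its left inverse sends a short path to the ordered product of the α_ik^g, where g is the class of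
the (i, k)-coordinate of the path. This product is not multiplicative on arbitrary arrays in G, but
it is on arrays coming from labellings of a single tree (`arrayProd_treeArray_mul`), and that is
what the relations are for. Well-pointedness makes it apply locally: the open sets `treeNhd w T`
cover the space, and the final map of the NDR homotopy turns every cactus in `treeNhd w T` into a
labelling of T. A van Kampen argument by subdivision (`exists_holonomy`) then yields a homomorphism
on the fundamental group, and comparing generators shows that `cactusHom` is injective.

For surjectivity, the same cover and deformation write each loop as a product of elements coming
from the groups G^E(T). A loop moving a single edge of T is a product of elements α_ik^g with i the
start of that edge (`treeHom_mem`). -/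

namespace BasedCacti

open Filter
open scoped unitInterval

/-! ### Subdivision -/

/-- A property of maps out of a compact metric space `K` that holds for maps with image in a member
of an open cover, and for a map as soon as it holds for its composites with a family of
contractions of `K`, holds for all maps. -/
theorem subdivision_induction {K X ι κ : Type*} [PseudoMetricSpace K] [CompactSpace K] [Nonempty K]
    [TopologicalSpace X] (q : κ → C(K, K)) (hq : ∀ a, LipschitzWith (1 / 2) (q a))
    (O : ι → Set X) (hO : ∀ i, IsOpen (O i)) (hcov : ∀ x, ∃ i, x ∈ O i)
    (P : C(K, X) → Prop) (hstep : ∀ f : C(K, X), (∀ a, P (f.comp (q a))) → P f)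
    (hloc : ∀ (f : C(K, X)) (i), (∀ x, f x ∈ O i) → P f) (f : C(K, X)) : P f := by
  obtain ⟨δ, hδ, hball⟩ := lebesgue_number_lemma_of_metric (s := (Set.univ : Set K))
    (c := fun i => f ⁻¹' O i) isCompact_univ (fun i => (hO i).preimage f.continuous)
    (fun x _ => by
      obtain ⟨i, hi⟩ := hcov (f x)
      exact Set.mem_iUnion.2 ⟨i, hi⟩)
  obtain ⟨C, hC⟩ := Metric.isBounded_iff.1 (Metric.isBounded_of_compactSpace (s := (.univ : Set K)))
  -- After `m` contractions the image of `K` has diameter below the Lebesgue number `δ`, so it is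
  -- mapped into one member of the cover.
  obtain ⟨m, hm⟩ : ∃ m : ℕ, (1 / 2 : ℝ) ^ m * C < δ := by
    have h := (tendsto_pow_atTop_nhds_zero_of_lt_one (r := (1 / 2 : ℝ)) (by norm_num)
      (by norm_num)).mul_const C
    rw [zero_mul] at h
    exact (h.eventually (gt_mem_nhds hδ)).exists
  have base : ∀ c : C(K, K), LipschitzWith ((1 / 2) ^ m) c → P (f.comp c) := by
    intro c hc
    obtain ⟨x⟩ := ‹Nonempty K›
    obtain ⟨i, hi⟩ := hball (c x) trivial
    refine hloc _ i fun y => hi ?_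
    rw [Metric.mem_ball]
    refine lt_of_le_of_lt (hc.dist_le_mul y x) (lt_of_le_of_lt ?_ hm)
    have := hC (Set.mem_univ y) (Set.mem_univ x)
    push_cast
    gcongr
  -- Climb back from `m`-fold contractions to the identity; `k` counts the contractions still
  -- missing.
  have desc : ∀ k, ∀ c : C(K, K), ∀ j, j + k = m → LipschitzWith ((1 / 2) ^ j) c →
      P (f.comp c) := by
    intro k
    induction k with
    | zero => rintro c j rfl hc; exact base c hc
    | succ k ih =>
      intro c j hj hc
      refine hstep _ fun a => ?_
      rw [ContinuousMap.comp_assoc]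
      refine ih _ (j + 1) (by omega) ?_
      rw [pow_succ]
      exact hc.comp (hq a)
  have := desc m (ContinuousMap.id K) 0 (by omega) (by simpa using LipschitzWith.id)
  simpa using this

/-- The affine map of the unit interval onto its left half. -/
noncomputable def leftHalf : C(I, I) where
  toFun t := ⟨t / 2, by constructor <;> linarith [t.2.1, t.2.2]⟩
  continuous_toFun := by fun_prop

/-- The affine map of the unit interval onto its right half. -/
noncomputable def rightHalf : C(I, I) where
  toFun t := ⟨(1 + t) / 2, by constructor <;> linarith [t.2.1, t.2.2]⟩
  continuous_toFun := by fun_prop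

@[simp] theorem leftHalf_zero : leftHalf 0 = 0 := by ext; simp [leftHalf]

@[simp] theorem rightHalf_one : rightHalf 1 = 1 := by ext; simp [rightHalf]

theorem leftHalf_one : leftHalf 1 = rightHalf 0 := by ext; simp [rightHalf, leftHalf]

/-- The two halves, indexed by booleans. -/
noncomputable def half (b : Bool) : C(I, I) := if b then rightHalf else leftHalf

theorem lipschitzWith_half (b : Bool) : LipschitzWith (1 / 2) (half b) := by
  refine LipschitzWith.of_dist_le_mul fun x y => le_of_eq ?_
  rw [Subtype.dist_eq, Subtype.dist_eq, Real.dist_eq, Real.dist_eq]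
  have : (((1 / 2 : NNReal) : ℝ)) = |(1 / 2 : ℝ)| := by rw [abs_of_pos (by norm_num)]; simp
  rw [this, ← abs_mul]
  cases b <;> simp only [half, leftHalf, rightHalf] <;> congr 1 <;> simp <;> ring

/-- The affine map of the unit square onto one of its quarters. -/
noncomputable def quarter (b : Bool × Bool) : C(I × I, I × I) := (half b.1).prodMap (half b.2)

theorem lipschitzWith_quarter (b : Bool × Bool) : LipschitzWith (1 / 2) (quarter b) := by
  refine LipschitzWith.of_dist_le_mul fun x y => ?_
  rw [Prod.dist_eq, Prod.dist_eq, mul_max_of_nonneg _ _ (NNReal.coe_nonneg _)]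
  exact max_le_max ((lipschitzWith_half b.1).dist_le_mul _ _)
    ((lipschitzWith_half b.2).dist_le_mul _ _)

section Holonomy

variable {X : Type*} [TopologicalSpace X] {Γ : Type*} [Group Γ]

/-- The bottom side of the unit square. -/
def bottomSide : C(I, I × I) := ⟨fun s => (s, 0), by fun_prop⟩

/-- The top side of the unit square. -/
def topSide : C(I, I × I) := ⟨fun s => (s, 1), by fun_prop⟩

/-- The left side of the unit square. -/
def leftSide : C(I, I × I) := ⟨fun t => (0, t), by fun_prop⟩

/-- The right side of the unit square. -/
def rightSide : C(I, I × I) := ⟨fun t => (1, t), by fun_prop⟩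

/-- The product of the values of `F` on the pieces of the `m`-fold dyadic subdivision of a path. -/
noncomputable def develop (F : C(I, X) → Γ) : ℕ → C(I, X) → Γ
  | 0, γ => F γ
  | m + 1, γ => develop F m (γ.comp rightHalf) * develop F m (γ.comp leftHalf)

variable {F : C(I, X) → Γ}

theorem develop_eq_of_local {S : Set X}
    (hF : ∀ γ : C(I, X), (∀ t, γ t ∈ S) → F γ = F (γ.comp rightHalf) * F (γ.comp leftHalf))
    (m : ℕ) {γ : C(I, X)} (hγ : ∀ t, γ t ∈ S) : develop F m γ = F γ := by
  induction m generalizing γ with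
  | zero => rfl
  | succ m ih => rw [develop, ih (γ := γ.comp rightHalf) fun t => hγ _, ih (γ := γ.comp leftHalf) fun t => hγ _,
      hF γ hγ]

theorem develop_const (hF : ∀ x, F (.const I x) = 1) (m : ℕ) (x : X) :
    develop F m (.const I x) = 1 := by
  induction m with
  | zero => exact hF x
  | succ m ih => rw [develop, ContinuousMap.const_comp, ContinuousMap.const_comp, ih, one_mul]

/-- `F` is multiplicative on paths in `S` and on boundaries of squares in `S`. -/
structure MultiplicativeOn (F : C(I, X) → Γ) (S : Set X) : Prop where
  path : ∀ γ : C(I, X), (∀ t, γ t ∈ S) → F γ = F (γ.comp rightHalf) * F (γ.comp leftHalf)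
  square : ∀ f : C(I × I, X), (∀ t, f t ∈ S) →
    F (f.comp rightSide) * F (f.comp bottomSide) = F (f.comp topSide) * F (f.comp leftSide)

variable {ι : Type*} {O : ι → Set X}

/-- On a path inside one `O i`, refining the subdivision changes nothing. Stabilization passes from
the two halves to the whole path, with the depth shifted by one. -/
theorem exists_eventually_develop_eq (hO : ∀ i, IsOpen (O i)) (hcov : ∀ x, ∃ i, x ∈ O i)
    (hF : ∀ i, MultiplicativeOn F (O i)) (γ : C(I, X)) :
    ∃ g, ∀ᶠ m in atTop, develop F m γ = g := by
  refine subdivision_induction half lipschitzWith_half O hO hcov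
    (fun γ => ∃ g, ∀ᶠ m in atTop, develop F m γ = g) ?_ ?_ γ
  · intro γ h
    obtain ⟨g₁, h₁⟩ := h true
    obtain ⟨g₀, h₀⟩ := h false
    refine ⟨g₁ * g₀, ?_⟩
    rw [← map_add_atTop_eq_nat 1, eventually_map]
    filter_upwards [h₁, h₀] with m h₁ h₀
    rw [develop]
    exact congr_arg₂ _ h₁ h₀
  · intro γ i h
    exact ⟨F γ, Eventually.of_forall fun m => develop_eq_of_local (hF i).path m h⟩

/-- The boundary relations of the four quarters paste to that of the square, because each inner side
is shared by two quarters. -/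
theorem eventually_develop_square (hO : ∀ i, IsOpen (O i)) (hcov : ∀ x, ∃ i, x ∈ O i)
    (hF : ∀ i, MultiplicativeOn F (O i)) (f : C(I × I, X)) :
    ∀ᶠ m in atTop, develop F m (f.comp rightSide) * develop F m (f.comp bottomSide) =
      develop F m (f.comp topSide) * develop F m (f.comp leftSide) := by
  refine subdivision_induction quarter lipschitzWith_quarter O hO hcov
    (fun f => ∀ᶠ m in atTop, develop F m (f.comp rightSide) * develop F m (f.comp bottomSide) =
      develop F m (f.comp topSide) * develop F m (f.comp leftSide)) ?_ ?_ f
  · intro f h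
    rw [← map_add_atTop_eq_nat 1, eventually_map]
    filter_upwards [h (false, false), h (false, true), h (true, false), h (true, true)]
      with m h00 h01 h10 h11
    simp only [develop, ContinuousMap.comp_assoc] at *
    have e1 : (quarter (true, true)).comp rightSide = rightSide.comp rightHalf := by
      ext t <;> simp [quarter, half, rightSide]
    have e2 : (quarter (true, false)).comp rightSide = rightSide.comp leftHalf := by
      ext t <;> simp [quarter, half, rightSide]
    have e3 : (quarter (true, false)).comp bottomSide = bottomSide.comp rightHalf := by
      ext t <;> simp [quarter, half, bottomSide]
    have e4 : (quarter (false, false)).comp bottomSide = bottomSide.comp leftHalf := by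
      ext t <;> simp [quarter, half, bottomSide]
    have e5 : (quarter (true, true)).comp topSide = topSide.comp rightHalf := by
      ext t <;> simp [quarter, half, topSide]
    have e6 : (quarter (false, true)).comp topSide = topSide.comp leftHalf := by
      ext t <;> simp [quarter, half, topSide]
    have e7 : (quarter (false, true)).comp leftSide = leftSide.comp rightHalf := by
      ext t <;> simp [quarter, half, leftSide]
    have e8 : (quarter (false, false)).comp leftSide = leftSide.comp leftHalf := by
      ext t <;> simp [quarter, half, leftSide]
    -- The next four equations identify the inner sides shared by adjacent quarters; the preceding
    -- eight identify the halves of the outer sides.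
    have c1 : (quarter (true, false)).comp topSide = (quarter (true, true)).comp bottomSide := by
      ext t <;> simp [quarter, half, topSide, bottomSide, leftHalf_one]
    have c2 : (quarter (false, false)).comp topSide = (quarter (false, true)).comp bottomSide := by
      ext t <;> simp [quarter, half, topSide, bottomSide, leftHalf_one]
    have c3 : (quarter (false, false)).comp rightSide = (quarter (true, false)).comp leftSide := by
      ext t <;> simp [quarter, half, rightSide, leftSide, leftHalf_one]
    have c4 : (quarter (false, true)).comp rightSide = (quarter (true, true)).comp leftSide := by
      ext t <;> simp [quarter, half, rightSide, leftSide, leftHalf_one]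
    rw [e4, c2, c3, e8] at h00
    rw [c4, e6, e7] at h01
    rw [e2, e3, c1] at h10
    rw [e1, e5] at h11
    rw [mul_assoc, ← mul_assoc (develop F m (f.comp (rightSide.comp leftHalf))), h10,
      mul_assoc, h00, ← mul_assoc, ← mul_assoc, h11, mul_assoc, mul_assoc,
      ← mul_assoc (develop F m (f.comp ((quarter (true, true)).comp leftSide))), h01]
    simp only [mul_assoc]
  · intro f i h
    refine Eventually.of_forall fun m => ?_
    rw [develop_eq_of_local (hF i).path m fun t => h _, develop_eq_of_local (hF i).path m fun t => h _,
      develop_eq_of_local (hF i).path m fun t => h _, develop_eq_of_local (hF i).path m fun t => h _]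
    exact (hF i).square f h

/-- A function on paths that is multiplicative on the members of an open cover
defines a homomorphism on the fundamental group. -/
theorem exists_holonomy (hO : ∀ i, IsOpen (O i)) (hcov : ∀ x, ∃ i, x ∈ O i)
    (hF : ∀ i, MultiplicativeOn F (O i)) (hconst : ∀ x, F (.const I x) = 1) (x₀ : X) :
    ∃ ψ : FundamentalGroup X x₀ →* Γ, ∀ γ : Path x₀ x₀,
      ∀ᶠ m in atTop, develop F m γ.toContinuousMap =
        ψ (FundamentalGroup.fromPath (Path.Homotopic.Quotient.mk γ)) := by
  choose v hv using exists_eventually_develop_eq hO hcov hF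
  have hom : ∀ γ δ : Path x₀ x₀, γ.Homotopic δ → v γ.toContinuousMap = v δ.toContinuousMap := by
    rintro γ δ ⟨H⟩
    -- A homotopy of loops is a square with constant bottom and top, so its boundary relation
    -- reduces to equality of the two remaining sides.
    have hs := eventually_develop_square hO hcov hF H.toContinuousMap
    have e1 : H.toContinuousMap.comp rightSide = δ.toContinuousMap := by
      ext t; exact H.apply_one t
    have e2 : H.toContinuousMap.comp leftSide = γ.toContinuousMap := by
      ext t; exact H.apply_zero t
    have e3 : H.toContinuousMap.comp bottomSide = .const I x₀ := by
      ext t; exact H.source t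
    have e4 : H.toContinuousMap.comp topSide = .const I x₀ := by
      ext t; exact H.target t
    rw [e1, e2, e3, e4] at hs
    obtain ⟨m, h1, h2, h3⟩ := (hs.and ((hv γ.toContinuousMap).and (hv δ.toContinuousMap))).exists
    rw [develop_const hconst, one_mul, mul_one, h2, h3] at h1
    exact h1.symm
  refine ⟨MonoidHom.mk' (fun c => Quotient.liftOn c (fun γ => v γ.toContinuousMap) hom) ?_, ?_⟩
  · intro a b
    induction a using Path.Homotopic.Quotient.ind with | mk γ => ?_
    induction b using Path.Homotopic.Quotient.ind with | mk δ => ?_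
    change v (δ.trans γ).toContinuousMap = v γ.toContinuousMap * v δ.toContinuousMap
    -- Depth `m + 1` for the concatenation matches depth `m` for the factors, since its two halves
    -- are the factors. Products in the fundamental group put the later path on the left.
    obtain ⟨m, h1, h2, h3⟩ := (((tendsto_add_atTop_nat 1).eventually
      (hv (δ.trans γ).toContinuousMap)).and
      ((hv γ.toContinuousMap).and (hv δ.toContinuousMap))).exists
    rw [← h1, ← h2, ← h3, develop]
    congr 2
    · ext t
      change (δ.trans γ) (rightHalf t) = γ t
      rw [Path.trans_apply]
      split_ifs with h
      · have h0 : t = 0 := by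
          apply Subtype.ext
          simp only [rightHalf, ContinuousMap.coe_mk] at h
          have := t.2.1
          simp only [Set.Icc.coe_zero]
          linarith
        subst h0
        rw [γ.source]
        convert δ.target
        simp [rightHalf]
      · congr 1
        ext
        simp [rightHalf]
        ring
    · ext t
      change (δ.trans γ) (leftHalf t) = δ t
      rw [Path.trans_apply, dif_pos]
      · congr 1
        ext
        simp [leftHalf]
        ring
      · simp only [leftHalf, ContinuousMap.coe_mk]
        linarith [t.2.2]
  · intro γ
    exact hv γ.toContinuousMap

end Holonomy

/-! ### Classes of free paths -/

section FreeClass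

variable {Z : Type*} [TopologicalSpace Z] {z₀ : Z} (C : ∀ z, Path z₀ z)

/-- The class of a path, closed up to a loop by chosen paths from the base point. -/
noncomputable def basedClass {x y : Z} (p : Path x y) : FundamentalGroup Z z₀ :=
  FundamentalGroup.fromPath (((Path.Homotopic.Quotient.mk (C x)).trans
    (Path.Homotopic.Quotient.mk p)).trans (Path.Homotopic.Quotient.mk (C y)).symm)

theorem basedClass_trans {x y z : Z} (p : Path x y) (q : Path y z) :
    basedClass C (p.trans q) = basedClass C q * basedClass C p := by
  rw [FundamentalGroup.mul_def]
  simp only [basedClass, Path.Homotopic.Quotient.mk_trans, Path.Homotopic.Quotient.trans_assoc]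
  rw [← Path.Homotopic.Quotient.trans_assoc _ (Path.Homotopic.Quotient.mk (C y)),
    Path.Homotopic.Quotient.symm_trans, Path.Homotopic.Quotient.refl_trans]

theorem basedClass_congr {x y x' y' : Z} {p : Path x y} {p' : Path x' y'}
    (h : ∀ t, p t = p' t) : basedClass C p = basedClass C p' := by
  obtain rfl : x = x' := by simpa using h 0
  obtain rfl : y = y' := by simpa using h 1
  obtain rfl : p = p' := Path.ext (funext h)
  rfl

theorem basedClass_eq_of_homotopic {x y : Z} {p q : Path x y} (h : p.Homotopic q) :
    basedClass C p = basedClass C q := by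
  rw [basedClass, basedClass, Path.Homotopic.Quotient.eq.2 h]

theorem basedClass_loop (hC : C z₀ = Path.refl z₀) (p : Path z₀ z₀) :
    basedClass C p = FundamentalGroup.fromPath (Path.Homotopic.Quotient.mk p) := by
  rw [basedClass, hC, Path.Homotopic.Quotient.mk_refl, Path.Homotopic.Quotient.refl_trans,
    ← Path.Homotopic.Quotient.mk_refl, ← Path.Homotopic.Quotient.mk_symm, Path.refl_symm,
    Path.Homotopic.Quotient.mk_refl, Path.Homotopic.Quotient.trans_refl]

/-- The class of a free path, closed up to a loop by chosen paths from the base point. -/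
noncomputable def freeClass (γ : C(I, Z)) : FundamentalGroup Z z₀ :=
  basedClass C (⟨γ, rfl, rfl⟩ : Path (γ 0) (γ 1))

theorem freeClass_toContinuousMap {x y : Z} (p : Path x y) :
    freeClass C p.toContinuousMap = basedClass C p :=
  basedClass_congr C fun _ => rfl

/-- In a simply connected space `r` is homotopic to `p` followed by `q`. The identities for halved
paths, for squares and for constant paths are all instances. -/
theorem freeClass_comp_eq_mul {K : Type*} [TopologicalSpace K] [SimplyConnectedSpace K]
    (f : C(K, Z)) {a b c : K} (p : Path a b) (q : Path b c) (r : Path a c) :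
    freeClass C (f.comp r.toContinuousMap) =
      freeClass C (f.comp q.toContinuousMap) * freeClass C (f.comp p.toContinuousMap) := by
  have hf : ∀ {a b : K} (p : Path a b),
      freeClass C (f.comp p.toContinuousMap) = basedClass C (p.map f.continuous) :=
    fun p => basedClass_congr C fun _ => rfl
  rw [hf, hf, hf, ← basedClass_trans, ← Path.map_trans]
  exact basedClass_eq_of_homotopic C
    ((SimplyConnectedSpace.paths_homotopic r (p.trans q)).map f)

theorem freeClass_const (z : Z) : freeClass C (.const I z) = 1 := by
  have h := freeClass_comp_eq_mul C (ContinuousMap.const Unit z) (Path.refl ()) (Path.refl ())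
    (Path.refl ())
  have e : (ContinuousMap.const Unit z).comp (Path.refl ()).toContinuousMap = .const I z := rfl
  rw [e] at h
  -- The class equals its own square.
  exact left_eq_mul.1 h

instance : ContractibleSpace I :=
  (convex_Icc (0 : ℝ) 1).contractibleSpace ⟨0, by simp⟩

theorem multiplicativeOn_freeClass : MultiplicativeOn (freeClass C) Set.univ where
  path γ _ :=
    freeClass_comp_eq_mul C γ (⟨leftHalf, leftHalf_zero, leftHalf_one⟩ : Path (0 : I) (rightHalf 0))
      (⟨rightHalf, rfl, rightHalf_one⟩ : Path (rightHalf 0) 1) (⟨.id I, rfl, rfl⟩ : Path (0 : I) 1)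
  square f _ := by
    -- Both ways around the square are compared with one path between opposite corners.
    have d : Path ((0, 0) : I × I) (1, 1) := PathConnectedSpace.somePath _ _
    exact (freeClass_comp_eq_mul C f (⟨bottomSide, rfl, rfl⟩ : Path ((0, 0) : I × I) (1, 0))
      (⟨rightSide, rfl, rfl⟩ : Path ((1, 0) : I × I) (1, 1)) d).symm.trans
      (freeClass_comp_eq_mul C f (⟨leftSide, rfl, rfl⟩ : Path ((0, 0) : I × I) (0, 1))
      (⟨topSide, rfl, rfl⟩ : Path ((0, 1) : I × I) (1, 1)) d)

theorem freeClass_path (γ : C(I, Z)) :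
    freeClass C γ = freeClass C (γ.comp rightHalf) * freeClass C (γ.comp leftHalf) :=
  (multiplicativeOn_freeClass C).path γ fun _ => trivial

end FreeClass

/-! ### Paths in rooted trees -/

namespace RootedTree

variable {V : Type u} [DecidableEq V] (T : RootedTree V)

/-- The distance of a vertex from the root. -/
def depth (k : V) : ℕ := Nat.find (T.reaches_root k)

variable {T} in
theorem depth_eq_zero {k : V} : T.depth k = 0 ↔ k = T.root := by
  rw [depth, Nat.find_eq_zero]
  rfl

variable {T} in
theorem depth_parent {k : V} (hk : k ≠ T.root) : T.depth k = T.depth (T.parent k) + 1 := by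
  have h0 : ¬ T.parent^[0] k = T.root := hk
  rw [depth, Nat.find_comp_succ (T.reaches_root k) (T.reaches_root (T.parent k)) h0]
  rfl

/-- Induction from the root to the leaves. -/
theorem vertex_induction {P : V → Prop} (root : P T.root)
    (step : ∀ k, k ≠ T.root → P (T.parent k) → P k) (k : V) : P k := by
  induction h : T.depth k generalizing k with
  | zero => exact depth_eq_zero.1 h ▸ root
  | succ m ih =>
    have hk : k ≠ T.root := fun e => by
      rw [depth_eq_zero.2 e] at h
      omega
    exact step k hk (ih _ (by rw [depth_parent hk] at h; omega))

/-- The edge leaving `i` on the path from the root to `k`, searched for in `m` steps. -/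
def towardAux (i : V) : ℕ → V → Option T.Edge
  | 0, _ => none
  | m + 1, k => if hk : k = T.root then none else
      if T.parent k = i then some ⟨k, hk⟩ else towardAux i m (T.parent k)

/-- The edge leaving `i` on the path from the root to `k`, if `i` is a proper ancestor of `k`. -/
def toward (i k : V) : Option T.Edge := T.towardAux i (T.depth k) k

@[simp] theorem toward_root (i : V) : T.toward i T.root = none := by
  rw [toward, depth_eq_zero.2 rfl, towardAux]

variable {T}

theorem toward_of_parent_eq {i k : V} (hk : k ≠ T.root) (h : T.parent k = i) :
    T.toward i k = some ⟨k, hk⟩ := by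
  rw [toward, depth_parent hk, towardAux, dif_neg hk, if_pos h]

theorem toward_of_parent_ne {i k : V} (hk : k ≠ T.root) (h : T.parent k ≠ i) :
    T.toward i k = T.toward i (T.parent k) := by
  rw [toward, depth_parent hk, towardAux, dif_neg hk, if_neg h, toward]

theorem depth_lt_of_toward {i k : V} (h : T.toward i k ≠ none) : T.depth i < T.depth k := by
  induction k using T.vertex_induction with
  | root => simp at h
  | step k hk ih =>
    rw [depth_parent hk]
    by_cases hp : T.parent k = i
    · rw [hp]; omega
    · rw [toward_of_parent_ne hk hp] at h
      have := ih h
      omega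

theorem parent_of_toward {i k : V} {e : T.Edge} (h : T.toward i k = some e) :
    T.parent e.1 = i := by
  induction k using T.vertex_induction with
  | root => simp at h
  | step k hk ih =>
    by_cases hp : T.parent k = i
    · rw [toward_of_parent_eq hk hp, Option.some_inj] at h
      rw [← h, hp]
    · rw [toward_of_parent_ne hk hp] at h
      exact ih h

/-- The edge of a path is on the path. -/
theorem toward_of_toward {i k : V} {e : T.Edge} (h : T.toward i k = some e) :
    e.1 = k ∨ T.toward e.1 k ≠ none := by
  induction k using T.vertex_induction with
  | root => simp at h
  | step k hk ih =>
    by_cases hp : T.parent k = i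
    · rw [toward_of_parent_eq hk hp, Option.some_inj] at h
      exact Or.inl (by rw [← h])
    · rw [toward_of_parent_ne hk hp] at h
      right
      by_cases hq : T.parent k = e.1
      · rw [toward_of_parent_eq hk hq]
        simp
      · rw [toward_of_parent_ne hk hq]
        exact (ih h).resolve_left (Ne.symm hq)

theorem toward_root_left {k : V} (hk : k ≠ T.root) : T.toward T.root k ≠ none := by
  induction k using T.vertex_induction with
  | root => exact absurd rfl hk
  | step k hk ih =>
    by_cases hp : T.parent k = T.root
    · rw [toward_of_parent_eq hk hp]
      simp
    · rw [toward_of_parent_ne hk hp]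
      exact ih hp

theorem toward_self (i : V) : T.toward i i = none := by
  by_contra h
  exact lt_irrefl _ (depth_lt_of_toward h)

theorem toward_eq_none_of_depth_le {i k : V} (h : T.depth k ≤ T.depth i) : T.toward i k = none := by
  by_contra h'
  have := depth_lt_of_toward h'
  omega

/-- If `j` is an ancestor of `k` but not of `i`, then the paths from `i` to `j` and `k` start with
the same edge. -/
theorem toward_eq_toward {i j k : V} (hij : i ≠ j) (hk : T.toward j k ≠ none)
    (hi : T.toward j i = none) : T.toward i k = T.toward i j := by
  induction k using T.vertex_induction with
  | root => simp at hk
  | step k hr ih =>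
    by_cases hp : T.parent k = j
    · rw [toward_of_parent_ne hr (by rw [hp]; exact hij.symm), hp]
    · rw [toward_of_parent_ne hr hp] at hk
      rw [toward_of_parent_ne hr, ih hk]
      rintro rfl
      exact hk hi

end RootedTree

/-! ### The coordinates of a based cactus -/

section Coord

variable {V : Type u} [DecidableEq V] {Y : Type v} (y₀ : Y)

/-- The label of the edge leaving `i` towards `k`; it is the base point if there is none. -/
def treeCoord (i k : V) (x : LabelledTree V Y) : Y := (x.1.toward i k).elim y₀ x.2

variable {y₀}

theorem treeCoord_root (i : V) (x : LabelledTree V Y) : treeCoord y₀ i x.1.root x = y₀ := by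
  simp [treeCoord]

theorem treeCoord_of_parent_eq {i k : V} {x : LabelledTree V Y} (hk : k ≠ x.1.root)
    (h : x.1.parent k = i) : treeCoord y₀ i k x = x.2 ⟨k, hk⟩ := by
  rw [treeCoord, RootedTree.toward_of_parent_eq hk h, Option.elim_some]

theorem treeCoord_of_parent_ne {i k : V} {x : LabelledTree V Y} (hk : k ≠ x.1.root)
    (h : x.1.parent k ≠ i) : treeCoord y₀ i k x = treeCoord y₀ i (x.1.parent k) x := by
  rw [treeCoord, RootedTree.toward_of_parent_ne hk h, treeCoord]

theorem toward_ne_none_of_treeCoord {i k : V} {x : LabelledTree V Y}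
    (h : treeCoord y₀ i k x ≠ y₀) : x.1.toward i k ≠ none := by
  intro h'
  rw [treeCoord, h'] at h
  exact h rfl

/-- Only the incoming edge of `j` changes. Its old label was trivial, and its new label is the one
already seen from the grandparent of `j` in the direction of `j`. Induction on depth carries this to
the descendants of `j`. -/
theorem treeCoord_reduction {x x' : LabelledTree V Y} (h : IsReduction y₀ x x') (i k : V) :
    treeCoord y₀ i k x = treeCoord y₀ i k x' := by
  obtain ⟨T, l, j, hj, hi, hl⟩ := h
  set x : LabelledTree V Y := ⟨T, l⟩
  set x' : LabelledTree V Y := ⟨T.cut j hj, fun e => if e.1 = j then l ⟨T.parent j, hi⟩ else l e⟩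
  have hpj : x'.1.parent j = T.parent (T.parent j) := Function.update_self ..
  have hpk : ∀ k, k ≠ j → x'.1.parent k = T.parent k := fun k hk => Function.update_of_ne hk ..
  have hne : T.parent j ≠ j := fun e => by
    have := RootedTree.depth_parent hj
    rw [e] at this
    omega
  induction h : T.depth k using Nat.strong_induction_on generalizing k with
  | _ d ih =>
    subst h
    by_cases hk : k = T.root
    · subst hk
      exact (treeCoord_root i x).trans (treeCoord_root i x').symm
    have hd := RootedTree.depth_parent hk
    by_cases hkj : k = j
    · subst hkj
      have hd' := RootedTree.depth_parent hi
      have ih' := ih (T.depth (T.parent (T.parent k))) (by omega) _ rfl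
      by_cases h1 : T.parent k = i
      · rw [treeCoord_of_parent_eq (x := x) hk h1, treeCoord_of_parent_ne (x := x') hk, hpj, ← ih']
        -- The old coordinate is the trivial label. The new one is read at the parent of `i`, where
        -- it is trivial because `i` does not lie above its own parent.
        · refine hl.trans ?_
          rw [treeCoord, RootedTree.toward_eq_none_of_depth_le]
          · rfl
          · rw [← h1]
            change T.depth (T.parent (T.parent k)) ≤ T.depth (T.parent k)
            omega
        · rw [hpj, ← h1]
          intro e
          rw [e] at hd'
          omega
      · rw [treeCoord_of_parent_ne (x := x) hk h1]
        by_cases h2 : T.parent (T.parent k) = i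
        · rw [treeCoord_of_parent_eq (x := x') hk (hpj.trans h2)]
          rw [treeCoord_of_parent_eq (x := x) hi h2]
          exact (if_pos rfl).symm
        · rw [treeCoord_of_parent_ne (x := x') hk (by rwa [hpj]), hpj,
            treeCoord_of_parent_ne (x := x) hi h2]
          exact ih'
    · have ih' := ih (T.depth (T.parent k)) (by omega) _ rfl
      by_cases h1 : T.parent k = i
      · rw [treeCoord_of_parent_eq (x := x) hk h1,
          treeCoord_of_parent_eq (x := x') hk ((hpk k hkj).trans h1)]
        exact (if_neg hkj).symm
      · rw [treeCoord_of_parent_ne (x := x) hk h1,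
          treeCoord_of_parent_ne (x := x') hk (by rwa [hpk k hkj]), hpk k hkj]
        exact ih'

/-- The label of the edge leaving `i` towards `k` in a based cactus. -/
def coord (i k : V) : BCact V y₀ → Y :=
  Quot.lift (treeCoord y₀ i k) fun _ _ h => treeCoord_reduction h i k

theorem continuous_coord [TopologicalSpace Y] (i k : V) :
    Continuous (coord i k : BCact V y₀ → Y) := by
  refine continuous_quot_lift _ (continuous_sigma fun T => ?_)
  change Continuous fun l : T.Edge → Y => (T.toward i k).elim y₀ l
  cases T.toward i k with
  | none => exact continuous_const
  | some e => exact continuous_apply e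

/-- A labelled tree is reduced if every edge that does not start at the root has a label different
from the base point. -/
def IsReduced (y₀ : Y) (x : LabelledTree V Y) : Prop :=
  ∀ e : x.1.Edge, x.1.parent e.1 ≠ x.1.root → x.2 e ≠ y₀

theorem IsReduced.treeCoord_ne {x : LabelledTree V Y} (hx : IsReduced y₀ x) {i k : V}
    (h : x.1.toward i k ≠ none) (hi : i ≠ x.1.root) : treeCoord y₀ i k x ≠ y₀ := by
  obtain ⟨e, he⟩ := Option.ne_none_iff_exists'.1 h
  rw [treeCoord, he]
  exact hx e (by rwa [RootedTree.parent_of_toward he])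

/-- For `i` not the root, reducedness makes the relation "`i` is a proper ancestor of `k`" readable
from the coordinates, so both trees share it. If the two parents of `k` differed, each of them would
be a proper ancestor of the other. -/
theorem parent_eq_of_treeCoord_eq {x x' : LabelledTree V Y} (hx : IsReduced y₀ x)
    (hx' : IsReduced y₀ x') (hr : x.1.root = x'.1.root)
    (h : ∀ i k, treeCoord y₀ i k x = treeCoord y₀ i k x') (k : V) :
    x.1.parent k = x'.1.parent k := by
  have anc : ∀ i k, i ≠ x.1.root → (x.1.toward i k ≠ none ↔ x'.1.toward i k ≠ none) := by
    intro i k hi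
    constructor
    · intro h'
      exact toward_ne_none_of_treeCoord (y₀ := y₀) (by rw [← h]; exact hx.treeCoord_ne h' hi)
    · intro h'
      exact toward_ne_none_of_treeCoord (y₀ := y₀)
        (by rw [h]; exact hx'.treeCoord_ne h' (by rwa [← hr]))
  by_cases hk : k = x.1.root
  · rw [hk, x.1.parent_root, hr, x'.1.parent_root]
  have hk' : k ≠ x'.1.root := by rwa [← hr]
  have hp : x.1.toward (x.1.parent k) k ≠ none := by
    rw [RootedTree.toward_of_parent_eq hk rfl]; simp
  have hp' : x'.1.toward (x'.1.parent k) k ≠ none := by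
    rw [RootedTree.toward_of_parent_eq hk' rfl]; simp
  by_contra hne
  have a1 : x.1.parent k ≠ x.1.root → x'.1.toward (x.1.parent k) (x'.1.parent k) ≠ none := by
    intro h1
    have := (anc _ _ h1).1 hp
    rwa [RootedTree.toward_of_parent_ne hk' (Ne.symm hne)] at this
  have a2 : x'.1.parent k ≠ x.1.root → x.1.toward (x'.1.parent k) (x.1.parent k) ≠ none := by
    intro h1
    have := (anc _ _ h1).2 hp'
    rwa [RootedTree.toward_of_parent_ne hk hne] at this
  by_cases h1 : x.1.parent k = x.1.root
  · rw [h1] at a2 hne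
    exact a2 (Ne.symm hne) (RootedTree.toward_root _ _)
  · by_cases h2 : x'.1.parent k = x.1.root
    · rw [h2, hr] at a1
      exact a1 (by rwa [← hr]) (RootedTree.toward_root _ _)
    · have b1 := RootedTree.depth_lt_of_toward ((anc _ _ h1).2 (a1 h1))
      have b2 := RootedTree.depth_lt_of_toward (a2 h2)
      omega

theorem IsReduced.eq_of_treeCoord_eq {x x' : LabelledTree V Y} (hx : IsReduced y₀ x)
    (hx' : IsReduced y₀ x') (hr : x.1.root = x'.1.root)
    (h : ∀ i k, treeCoord y₀ i k x = treeCoord y₀ i k x') : x = x' := by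
  have hp := parent_eq_of_treeCoord_eq hx hx' hr h
  obtain ⟨T, l⟩ := x
  obtain ⟨T', l'⟩ := x'
  obtain rfl : T = T' := RootedTree.ext hr (funext hp)
  congr 1
  funext e
  have := h (T.parent e.1) e.1
  rwa [treeCoord_of_parent_eq (x := ⟨T, l⟩) e.2 rfl,
    treeCoord_of_parent_eq (x := ⟨T, l'⟩) e.2 rfl] at this

theorem depth_cut_le (T : RootedTree V) (j : V) (hj : j ≠ T.root) (k : V) :
    (T.cut j hj).depth k ≤ T.depth k := by
  induction h : T.depth k using Nat.strong_induction_on generalizing k with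
  | _ d ih =>
    subst h
    by_cases hk : k = T.root
    · subst hk
      exact (RootedTree.depth_eq_zero (T := T.cut j hj)).2 rfl |>.trans_le (Nat.zero_le _)
    have hd := RootedTree.depth_parent hk
    have hd' := RootedTree.depth_parent (T := T.cut j hj) hk
    by_cases hkj : k = j
    · subst hkj
      have hp : (T.cut k hj).parent k = T.parent (T.parent k) := Function.update_self ..
      by_cases hi : T.parent k = T.root
      · have := ih _ (by omega) (T.parent k) rfl
        rw [hp, hi, T.parent_root] at hd'
        rw [hi] at this hd
        omega
      · have h2 := RootedTree.depth_parent hi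
        have := ih (T.depth (T.parent (T.parent k))) (by omega) _ rfl
        rw [hp] at hd'
        omega
    · have hp : (T.cut j hj).parent k = T.parent k := Function.update_of_ne hkj ..
      have := ih _ (by omega) (T.parent k) rfl
      rw [hp] at hd'
      omega

theorem depth_cut_lt (T : RootedTree V) (j : V) (hj : j ≠ T.root) (hi : T.parent j ≠ T.root) :
    (T.cut j hj).depth j < T.depth j := by
  have hd := RootedTree.depth_parent hj
  have hd' := RootedTree.depth_parent (T := T.cut j hj) hj
  have h2 := RootedTree.depth_parent hi
  have hp : (T.cut j hj).parent j = T.parent (T.parent j) := Function.update_self ..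
  have := depth_cut_le T j hj (T.parent (T.parent j))
  rw [hp] at hd'
  omega

/-- Reductions terminate: each one lowers the sum of the depths of all vertices. -/
theorem exists_isReduced [Fintype V] (x : LabelledTree V Y) :
    ∃ x' : LabelledTree V Y, x'.1.root = x.1.root ∧ IsReduced y₀ x' ∧
      (Quot.mk _ x' : BCact V y₀) = Quot.mk _ x := by
  induction h : ∑ k, x.1.depth k using Nat.strong_induction_on generalizing x with
  | _ d ih =>
    subst h
    by_cases hx : IsReduced y₀ x
    · exact ⟨x, rfl, hx, rfl⟩
    · obtain ⟨T, l⟩ := x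
      simp only [IsReduced, not_forall, not_not] at hx
      obtain ⟨⟨j, hj⟩, hi, hl⟩ := hx
      have hred := IsReduction.mk T l j hj hi hl
      obtain ⟨x', h1, h2, h3⟩ := ih _ (Finset.sum_lt_sum (fun k _ => depth_cut_le T j hj k)
        ⟨j, Finset.mem_univ j, depth_cut_lt T j hj hi⟩) ⟨T.cut j hj, _⟩ rfl
      exact ⟨x', h1, h2, h3.trans (Quot.sound hred).symm⟩

theorem BCactRoot.ext [Fintype V] {r : V} {a b : BCactRoot y₀ r}
    (h : ∀ i k, coord i k a.1 = coord i k b.1) : a = b := by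
  obtain ⟨a, ha⟩ := a
  obtain ⟨b, hb⟩ := b
  apply Subtype.ext
  induction a using Quot.ind with | mk x => ?_
  induction b using Quot.ind with | mk x' => ?_
  obtain ⟨z, h1, h2, h3⟩ := exists_isReduced (y₀ := y₀) x
  obtain ⟨z', h1', h2', h3'⟩ := exists_isReduced (y₀ := y₀) x'
  change Quot.mk _ x = Quot.mk _ x'
  rw [← h3, ← h3', h2.eq_of_treeCoord_eq h2' (h1.trans (Eq.trans ha (h1'.trans hb).symm))]
  intro i k
  have := h i k
  change coord i k (Quot.mk _ x) = coord i k (Quot.mk _ x') at this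
  rw [← h3, ← h3'] at this
  exact this

end Coord

/-! ### Products of generators along trees -/

section CactusProduct

open scoped commutatorElement

theorem commute_of_isRelator {V : Type u} {r : V} {G : Type v} [Group G]
    {a b : FreeGroup (Gen r G)}
    (h : IsRelator r G ⁅a, b⁆) :
    Commute (PresentedGroup.mk {w | IsRelator r G w} a) (PresentedGroup.mk _ b) := by
  have := PresentedGroup.one_of_mem (show _ ∈ {w | IsRelator r G w} from h)
  rw [map_commutatorElement] at this
  exact commutatorElement_eq_one_iff_commute.1 this

variable {V : Type u} [DecidableEq V] (r : V) {G : Type v} [Group G]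

/-- The homomorphism `g ↦ α_{ik}^g`, which is trivial if there is no such generator. -/
def genHom (i k : V) : G →* CactusGroup r G :=
  if h : i ≠ k ∧ k ≠ r then
    MonoidHom.mk' (fun g => PresentedGroup.of ⟨i, k, h.1, h.2, g⟩) fun g g' => by
      have := PresentedGroup.one_of_mem (show _ ∈ {w | IsRelator r G w} from
        IsRelator.mul i k h.1 h.2 g g')
      simp only [map_mul, map_inv, mul_inv_eq_one] at this
      exact this.symm
  else 1

variable {r}

theorem genHom_apply {i k : V} (hik : i ≠ k) (hk : k ≠ r) (g : G) :
    genHom r i k g = PresentedGroup.of ⟨i, k, hik, hk, g⟩ := by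
  rw [genHom, dif_pos ⟨hik, hk⟩]
  rfl

theorem genHom_eq_one {i k : V} (h : i = k ∨ k = r) (g : G) : genHom r i k g = 1 := by
  rw [genHom, dif_neg (by tauto)]
  rfl

theorem commute_genHom_same {i j k : V} (hjk : j ≠ k) (g h : G) :
    Commute (genHom r i j g) (genHom r i k h) := by
  by_cases hj : i = j ∨ j = r
  · rw [genHom_eq_one hj]; exact Commute.one_left _
  by_cases hk : i = k ∨ k = r
  · rw [genHom_eq_one hk]; exact Commute.one_right _
  rw [not_or] at hj hk
  rw [genHom_apply hj.1 hj.2, genHom_apply hk.1 hk.2]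
  exact commute_of_isRelator (.comm_same i j k hj.1 hk.1 hjk hj.2 hk.2 g h)

theorem commute_genHom_disjoint {i j k l : V} (hik : i ≠ k) (hil : i ≠ l) (hjk : j ≠ k)
    (hjl : j ≠ l) (g h : G) : Commute (genHom r i j g) (genHom r k l h) := by
  by_cases hj : i = j ∨ j = r
  · rw [genHom_eq_one hj]; exact Commute.one_left _
  by_cases hk : k = l ∨ l = r
  · rw [genHom_eq_one hk]; exact Commute.one_right _
  rw [not_or] at hj hk
  rw [genHom_apply hj.1 hj.2, genHom_apply hk.1 hk.2]
  exact commute_of_isRelator (.comm_disjoint i j k l hj.1 hik hil hjk hjl hk.1 hj.2 hk.2 g h)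

theorem commute_genHom_triple {i j k : V} (hij : i ≠ j) (hik : i ≠ k) (hjk : j ≠ k) (hj : j ≠ r)
    (g h : G) : Commute (genHom r i j g * genHom r i k g) (genHom r j k h) := by
  by_cases hk : k = r
  · rw [genHom_eq_one (r := r) (i := j) (Or.inr hk)]; exact Commute.one_right _
  rw [genHom_apply hij hj, genHom_apply hik hk, genHom_apply hjk hk]
  exact commute_of_isRelator (.comm_triple i j k hij hik hjk hj hk g h)

variable [Fintype V]

/-- The product of the elements `α_{ik}^{g k}` over all `k`. -/
def rowHom (r : V) (i : V) : (V → G) →* CactusGroup r G :=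
  MonoidHom.noncommPiCoprod (fun k => genHom r i k) fun _ _ hjk g h => commute_genHom_same hjk g h

theorem rowHom_mulSingle (i k : V) (g : G) :
    rowHom r i (Pi.mulSingle k g) = genHom r i k g :=
  MonoidHom.noncommPiCoprod_mulSingle ..

theorem commute_rowHom {x : CactusGroup r G} {i : V} {g : V → G}
    (h : ∀ k, Commute x (genHom r i k (g k))) : Commute x (rowHom r i g) :=
  Finset.noncommProd_commute _ _ (fun _ _ _ _ hjk => commute_genHom_same hjk _ _) _ fun k _ => h k

/-- The product of the elements `α_{ik}^{g i k}` over all `i` and `k`, in a fixed order. -/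
noncomputable def arrayProd (r : V) (g : V → V → G) : CactusGroup r G :=
  (Finset.univ.toList.map fun i => rowHom r i (g i)).prod

theorem arrayProd_one : arrayProd r (1 : V → V → G) = 1 := by
  refine List.prod_eq_one fun x hx => ?_
  obtain ⟨i, -, rfl⟩ := List.mem_map.1 hx
  exact map_one _

theorem arrayProd_single {i k : V} (g : G) :
    arrayProd r (Pi.mulSingle i (Pi.mulSingle k g)) = genHom r i k g := by
  rw [arrayProd, List.prod_map_eq_pow_single i]
  · rw [List.count_eq_one_of_mem (Finset.nodup_toList _) (by simp), pow_one, Pi.mulSingle_eq_same,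
      rowHom_mulSingle]
  · intro i' hi' _
    rw [Pi.mulSingle_eq_of_ne hi', map_one]

/-- Interleaving moves each `g` factor past `f` factors of other indices only, so nothing is needed
about `f i` and `g i`. -/
theorem list_prod_mul_of_commute {ι M : Type*} [Monoid M] {l : List ι} (hl : l.Nodup)
    {f g : ι → M} (h : ∀ i j, i ≠ j → Commute (f i) (g j)) :
    (l.map fun i => f i * g i).prod = (l.map f).prod * (l.map g).prod := by
  induction l with
  | nil => simp
  | cons a l ih =>
    rw [List.nodup_cons] at hl
    have hc : Commute (g a) (l.map f).prod := by
      refine Commute.list_prod_right _ _ fun x hx => ?_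
      obtain ⟨i, hi, rfl⟩ := List.mem_map.1 hx
      exact (h i a fun e => hl.1 (e ▸ hi)).symm
    simp only [List.map_cons, List.prod_cons, ih hl.2]
    rw [mul_assoc, mul_assoc, ← mul_assoc (g a), hc.eq, mul_assoc]

theorem arrayProd_mul {g g' : V → V → G}
    (h : ∀ i j, i ≠ j → Commute (rowHom r i (g i)) (rowHom r j (g' j))) :
    arrayProd r (g * g') = arrayProd r g * arrayProd r g' := by
  rw [arrayProd, arrayProd, arrayProd, ← list_prod_mul_of_commute (Finset.nodup_toList _) h]
  simp only [Pi.mul_apply, map_mul]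

/-- The array with entry `x e` at `(i, k)` if `e` is the edge leaving `i` towards `k`. -/
def treeArray (T : RootedTree V) (x : T.Edge → G) (i k : V) : G := (T.toward i k).elim 1 x

/-- It suffices to treat one factor α_jk^h with `k` below `j`. Since `j` is not above `i`, the
entries of row `i` at `j` and `k` agree, say with value g, and α_ij^g α_ik^g commutes with α_jk^h by
the last relation. The other factors of row `i` have both indices different from `j` and `k`, so
they commute with it by the disjoint relation. -/
theorem commute_rowHom_treeArray_of_toward_eq_none {T : RootedTree V} (hT : T.root = r)
    (x x' : T.Edge → G) {i j : V} (hij : i ≠ j) (hji : T.toward j i = none) :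
    Commute (rowHom r i (treeArray T x i)) (rowHom r j (treeArray T x' j)) := by
  refine commute_rowHom fun k => ?_
  by_cases hk : T.toward j k = none
  · rw [treeArray, hk, Option.elim_none, map_one]
    exact Commute.one_right _
  have hjr : j ≠ r := by
    rintro rfl
    rw [← hT] at hji hij
    exact RootedTree.toward_root_left hij hji
  have hik : i ≠ k := fun e => hk (e ▸ hji)
  have hjk : j ≠ k := by
    rintro rfl
    exact hk (RootedTree.toward_self _)
  have hx : treeArray T x i k = treeArray T x i j := by
    rw [treeArray, RootedTree.toward_eq_toward hij hk hji, treeArray]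
  set g := treeArray T x i
  have hg : g = (Pi.mulSingle j (g j) * Pi.mulSingle k (g j)) *
      fun l => if l = j ∨ l = k then 1 else g l := by
    funext l
    by_cases h1 : l = j
    · subst h1; simp [Pi.mulSingle_eq_of_ne hjk]
    · by_cases h2 : l = k
      · subst h2; simp [Pi.mulSingle_eq_of_ne h1, hx]
      · simp [h1, h2]
  rw [hg, map_mul, map_mul, rowHom_mulSingle, rowHom_mulSingle]
  refine Commute.mul_left (commute_genHom_triple hij hik hjk hjr _ _) ?_
  refine (commute_rowHom fun l => ?_).symm
  by_cases hl : l = j ∨ l = k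
  · rw [if_pos hl, map_one]
    exact Commute.one_right _
  · rw [not_or] at hl
    exact (commute_genHom_disjoint hij hik hl.1 hl.2 _ _).symm

/-- Of two distinct vertices at least one is not an ancestor of the other, so any two distinct rows
commute. -/
theorem arrayProd_treeArray_mul {T : RootedTree V} (hT : T.root = r) (x x' : T.Edge → G) :
    arrayProd r (treeArray T (x * x')) =
      arrayProd r (treeArray T x) * arrayProd r (treeArray T x') := by
  rw [← arrayProd_mul]
  · congr 1
    funext i k
    simp only [treeArray, Pi.mul_apply]
    cases T.toward i k <;> simp
  · intro i j hij
    by_cases h : T.toward j i = none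
    · exact commute_rowHom_treeArray_of_toward_eq_none hT x x' hij h
    · exact (commute_rowHom_treeArray_of_toward_eq_none hT x' x hij.symm
        (RootedTree.toward_eq_none_of_depth_le (RootedTree.depth_lt_of_toward h).le)).symm

end CactusProduct

/-! ### Trees with few edges away from the root -/

section Marks

variable {V : Type u} {r : V}

/-- The tree with root `r` and edges `i ⟶ k` for `k ∈ D` and `r ⟶ k` for all other `k`. -/
noncomputable def RootedTree.star (r i : V) (D : Set V) (hi : i ∉ D) (hr : r ∉ D) :
    RootedTree V where
  root := r
  parent k := open Classical in if k ∈ D then i else r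
  parent_root := if_neg hr
  reaches_root k := by
    refine ⟨2, ?_⟩
    by_cases hk : k ∈ D <;> simp [hk, hi, hr]

theorem RootedTree.root_star {i : V} {D : Set V} (hi : i ∉ D) (hr : r ∉ D) :
    (star r i D hi hr).root = r := rfl

variable [DecidableEq V]

/-- The edge leaving `i` towards `k` exists and ends in `D`. -/
def RootedTree.Marks (T : RootedTree V) (D : Set V) (i k : V) : Prop :=
  ∃ e, T.toward i k = some e ∧ e.1 ∈ D

theorem RootedTree.marks_root {T : RootedTree V} (hT : T.root = r) (D : Set V) (i : V) :
    ¬ T.Marks D i r := by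
  rintro ⟨e, he, -⟩
  rw [← hT, T.toward_root] at he
  cases he

theorem RootedTree.marks_iff {T : RootedTree V} (hT : T.root = r) {D : Set V} {i k : V}
    (hk : k ≠ r) :
    T.Marks D i k ↔ if T.parent k = i then k ∈ D else T.Marks D i (T.parent k) := by
  subst hT
  split_ifs with h
  · rw [Marks, toward_of_parent_eq hk h]
    simp
  · rw [Marks, toward_of_parent_ne hk h, Marks]

theorem RootedTree.marks_star {i : V} {D D' : Set V} (hi : i ∉ D) (hr : r ∉ D) (hD : D' ⊆ D)
    (i' k : V) : (star r i D hi hr).Marks D' i' k ↔ i' = i ∧ k ∈ D' := by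
  classical
  have hs : ∀ k, (star r i D hi hr).parent k = if k ∈ D then i else r := fun _ => rfl
  have hr' : ¬ (star r i D hi hr).Marks D' i' r := marks_root rfl _ _
  have hout : ∀ k, k ∉ D → ¬ (star r i D hi hr).Marks D' i' k := by
    intro k hk
    by_cases hkr : k = r
    · rwa [hkr]
    rw [marks_iff rfl hkr, hs, if_neg hk]
    split_ifs
    · exact fun h => hk (hD h)
    · exact hr'
  by_cases hk : k ∈ D
  · have hkr : k ≠ r := fun e => hr (e ▸ hk)
    rw [marks_iff rfl hkr, hs, if_pos hk]
    split_ifs with h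
    · simp [h]
    · simp [Ne.symm h, hout i hi]
  · simp only [hout k hk, false_iff, not_and]
    exact fun _ h => hk (hD h)

/-- The tree with root `r`, the edges `i ⟶ j` and `k ⟶ l`, and all other edges starting at `r`. -/
def RootedTree.twoBranch (r i j k l : V) (hij : i ≠ j) (hil : i ≠ l) (hkl : k ≠ l)
    (hj : j ≠ r) (hl : l ≠ r) : RootedTree V where
  root := r
  parent m := if m = j then i else if m = l then k else r
  parent_root := by rw [if_neg hj.symm, if_neg hl.symm]
  reaches_root m := by
    refine ⟨3, ?_⟩
    by_cases hmj : m = j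
    · simp [hmj, hij, hil, hj.symm, hl.symm]
    · by_cases hml : m = l
      · subst hml
        by_cases hkj : k = j
        · simp [hmj, hkj, hij, hil]
        · simp [hmj, hkj, hkl, hj.symm, hl.symm]
      · simp [hmj, hml, hj.symm, hl.symm]

theorem RootedTree.marks_twoBranch {i j k l : V} (hij : i ≠ j) (hil : i ≠ l) (hkl : k ≠ l)
    (hjl : j ≠ l) (hj : j ≠ r) (hl : l ≠ r) {D : Set V} (hD : D ⊆ {j, l}) (i' m : V) :
    (twoBranch r i j k l hij hil hkl hj hl).Marks D i' m ↔
      (m = j ∧ i' = i ∧ j ∈ D) ∨ (m = l ∧ i' = k ∧ l ∈ D) ∨ (m = l ∧ k = j ∧ i' = i ∧ j ∈ D) := by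
  set T := twoBranch r i j k l hij hil hkl hj hl
  have hs : ∀ m, T.parent m = if m = j then i else if m = l then k else r := fun _ => rfl
  have hr : ¬ T.Marks D i' r := marks_root rfl _ _
  have hout : ∀ m, m ≠ j → m ≠ l → ¬ T.Marks D i' m := by
    intro m hmj hml
    by_cases hmr : m = r
    · rwa [hmr]
    rw [marks_iff rfl hmr, hs, if_neg hmj, if_neg hml]
    split_ifs
    · intro h
      rcases hD h with h | h
      · exact hmj h
      · exact hml h
    · exact hr
  have hmj : T.Marks D i' j ↔ i' = i ∧ j ∈ D := by
    rw [marks_iff rfl hj, hs, if_pos rfl]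
    split_ifs with h
    · simp [h]
    · simp [Ne.symm h, hout i hij hil]
  by_cases h1 : m = j
  · subst h1
    simp [hmj, hjl]
  · by_cases h2 : m = l
    · subst h2
      rw [marks_iff rfl hl, hs, if_neg h1, if_pos rfl]
      by_cases h3 : k = j
      · subst h3
        split_ifs with h
        · subst h
          simp [h1, hij.symm]
        · simp [h1, Ne.symm h, hmj]
      · split_ifs with h
        · subst h
          simp [h1, h3]
        · simp [h1, Ne.symm h, hout k h3 hkl, h3]
    · simp [h1, h2, hout]

end Marks

/-! ### Maps of powers of the label space into the space of based cacti -/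

theorem mapOfEq_mk {A B : Type*} [TopologicalSpace A] [TopologicalSpace B] (f : C(A, B)) {a : A}
    {b : B} (h : f a = b) (γ : Path a a) (p : Path b b) (hp : ∀ t, p t = f (γ t)) :
    FundamentalGroup.mapOfEq f h (FundamentalGroup.fromPath (Path.Homotopic.Quotient.mk γ)) =
      FundamentalGroup.fromPath (Path.Homotopic.Quotient.mk p) := by
  subst h
  rw [FundamentalGroup.mapOfEq_apply, Path.Homotopic.Quotient.cast_rfl_rfl]
  exact congr_arg Path.Homotopic.Quotient.mk (Path.ext (funext fun t => (hp t).symm))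

/-- A tuple of loops as a loop in a power of the space. -/
noncomputable def piHom {Y : Type v} [TopologicalSpace Y] (y₀ : Y) (ι : Type u) :
    (ι → FundamentalGroup Y y₀) →* FundamentalGroup (ι → Y) (fun _ => y₀) where
  toFun g := FundamentalGroup.fromPath (Path.Homotopic.pi g)
  map_one' := by
    change Path.Homotopic.pi (fun _ => Path.Homotopic.Quotient.mk (Path.refl y₀)) = _
    rw [Path.Homotopic.pi_lift]
    rfl
  map_mul' g h := (Path.Homotopic.comp_pi_eq_pi_comp h g).symm

theorem piHom_mk {Y : Type v} [TopologicalSpace Y] {y₀ : Y} {ι : Type u}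
    (γ : ι → Path y₀ y₀) :
    piHom y₀ ι (fun e => FundamentalGroup.fromPath (Path.Homotopic.Quotient.mk (γ e))) =
      FundamentalGroup.fromPath (Path.Homotopic.Quotient.mk (Path.pi γ)) :=
  Path.Homotopic.pi_lift γ

theorem coord_base {V : Type u} [DecidableEq V] {Y : Type v} {y₀ : Y} {r : V} (i k : V) :
    coord i k (BCactRoot.base y₀ r).1 = y₀ := by
  change ((RootedTree.corolla r).toward i k).elim y₀ (fun _ => y₀) = y₀
  cases (RootedTree.corolla r).toward i k <;> rfl

section TreeMap

variable {V : Type u} [DecidableEq V] {Y : Type v} [TopologicalSpace Y] (y₀ : Y) {r : V}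

/-- The map that sends a labelling of a fixed tree to the class of the labelled tree. -/
def treeMap (T : RootedTree V) (hT : T.root = r) : C(T.Edge → Y, BCactRoot y₀ r) where
  toFun l := ⟨Quot.mk _ ⟨T, l⟩, hT⟩
  continuous_toFun := by
    refine Continuous.subtype_mk (continuous_quot_mk.comp (continuous_sigmaMk.comp ?_)) _
    exact continuous_id

variable {y₀}

theorem coord_treeMap (T : RootedTree V) (hT : T.root = r) (l : T.Edge → Y) (i k : V) :
    coord i k (treeMap y₀ T hT l).1 = (T.toward i k).elim y₀ l := rfl

theorem exists_treeMap_eq (x : BCactRoot y₀ r) :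
    ∃ (T : RootedTree V) (hT : T.root = r) (l : T.Edge → Y), x = treeMap y₀ T hT l := by
  obtain ⟨x, hx⟩ := x
  induction x using Quot.ind with | mk x => ?_
  exact ⟨x.1, hx, x.2, rfl⟩

open Classical in
theorem coord_treeMap_ite (T : RootedTree V) (hT : T.root = r) (D : Set V) (y : Y) (i k : V) :
    coord i k (treeMap y₀ T hT fun e => if e.1 ∈ D then y else y₀).1 =
      if T.Marks D i k then y else y₀ := by
  rw [coord_treeMap, RootedTree.Marks]
  cases T.toward i k <;> simp

theorem coord_branchMap {i j : V} (hij : i ≠ j) (hj : j ≠ r) (y : Y) (i' k : V) :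
    coord i' k (branchMap y₀ r i j hij hj y).1 = if i' = i ∧ k = j then y else y₀ := by
  classical
  have hi : i ∉ ({j} : Set V) := hij
  have hr : r ∉ ({j} : Set V) := hj.symm
  have hb : RootedTree.branch r i j hij hj = RootedTree.star r i {j} hi hr := by
    ext k
    · rfl
    · simp [RootedTree.branch, RootedTree.star]
  have hrb : (RootedTree.branch r i j hij hj).root = r := rfl
  have hm := RootedTree.marks_star hi hr (subset_rfl : ({j} : Set V) ⊆ {j}) i' k
  rw [← hb, Set.mem_singleton_iff] at hm
  simp only [← hm]
  refine Eq.trans ?_ (coord_treeMap_ite (RootedTree.branch r i j hij hj) hrb {j} y i' k)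
  refine congrArg (fun l => coord i' k (treeMap y₀ (RootedTree.branch r i j hij hj) hrb l).1)
    (a₁ := fun e => if e.1 = j then y else y₀) (funext fun e => ?_)
  by_cases he : e.1 = j
  · rw [if_pos he, if_pos (Set.mem_singleton_iff.2 he)]
  · rw [if_neg he, if_neg (mt Set.mem_singleton_iff.1 he)]

/-- The loop that labels the edge `i ⟶ j` of `branchMap` by a given loop. -/
def branchLoop {i j : V} (hij : i ≠ j) (hj : j ≠ r) (γ : Path y₀ y₀) :
    Path (BCactRoot.base y₀ r) (BCactRoot.base y₀ r) where
  toFun t := branchMap y₀ r i j hij hj (γ t)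
  continuous_toFun := (branchMap y₀ r i j hij hj).continuous.comp γ.continuous
  source' := by simp [branchMap_base]
  target' := by simp [branchMap_base]

theorem alpha_mk {i j : V} (hij : i ≠ j) (hj : j ≠ r) (γ : Path y₀ y₀) :
    alpha y₀ r i j hij hj (FundamentalGroup.fromPath (Path.Homotopic.Quotient.mk γ)) =
      FundamentalGroup.fromPath (Path.Homotopic.Quotient.mk (branchLoop hij hj γ)) :=
  mapOfEq_mk _ _ γ _ fun _ => rfl

variable [Fintype V]

theorem treeMap_base (T : RootedTree V) (hT : T.root = r) :
    treeMap y₀ T hT (fun _ => y₀) = BCactRoot.base y₀ r := by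
  refine BCactRoot.ext fun i k => ?_
  rw [coord_base, coord_treeMap]
  cases T.toward i k <;> rfl

variable (y₀) in
/-- The homomorphism on fundamental groups induced by `treeMap`. -/
noncomputable def treeHom (T : RootedTree V) (hT : T.root = r) :
    (T.Edge → FundamentalGroup Y y₀) →*
      FundamentalGroup (BCactRoot y₀ r) (BCactRoot.base y₀ r) :=
  (FundamentalGroup.mapOfEq (treeMap y₀ T hT) (treeMap_base T hT)).comp (piHom y₀ T.Edge)

theorem treeHom_mk (T : RootedTree V) (hT : T.root = r) (γ : T.Edge → Path y₀ y₀)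
    (p : Path (BCactRoot.base y₀ r) (BCactRoot.base y₀ r))
    (hp : ∀ t, p t = treeMap y₀ T hT fun e => γ e t) :
    treeHom y₀ T hT (fun e => FundamentalGroup.fromPath (Path.Homotopic.Quotient.mk (γ e))) =
      FundamentalGroup.fromPath (Path.Homotopic.Quotient.mk p) := by
  rw [treeHom, MonoidHom.comp_apply, piHom_mk]
  exact mapOfEq_mk _ _ _ _ hp

open Classical in
/-- The loop in the space of based cacti that moves the labels of the edges of `T` ending in `D`
simultaneously. -/
noncomputable def markHom (T : RootedTree V) (hT : T.root = r) (D : Set V)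
    (g : FundamentalGroup Y y₀) : FundamentalGroup (BCactRoot y₀ r) (BCactRoot.base y₀ r) :=
  treeHom y₀ T hT fun e => if e.1 ∈ D then g else 1

theorem markHom_mk (T : RootedTree V) (hT : T.root = r) (D : Set V) (γ : Path y₀ y₀)
    (p : Path (BCactRoot.base y₀ r) (BCactRoot.base y₀ r))
    (hp : ∀ t i k, (T.Marks D i k → coord i k (p t).1 = γ t) ∧
      (¬ T.Marks D i k → coord i k (p t).1 = y₀)) :
    markHom T hT D (FundamentalGroup.fromPath (Path.Homotopic.Quotient.mk γ)) =
      FundamentalGroup.fromPath (Path.Homotopic.Quotient.mk p) := by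
  classical
  rw [← treeHom_mk T hT (fun e => if e.1 ∈ D then γ else Path.refl y₀) p, markHom]
  · congr 1
    funext e
    split_ifs <;> rfl
  · intro t
    have : (fun e : T.Edge => (if e.1 ∈ D then γ else Path.refl y₀) t) =
        fun e => if e.1 ∈ D then γ t else y₀ := by
      funext e
      split_ifs <;> rfl
    rw [this]
    refine BCactRoot.ext fun i k => ?_
    rw [coord_treeMap_ite]
    split_ifs with h
    · exact (hp t i k).1 h
    · exact (hp t i k).2 h

/-- A representing loop of one side is literally the same loop of cacti as that of the other,
because all coordinates agree; no homotopy is needed. This lets a loop be carried from one tree to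
another. -/
theorem markHom_congr {T T' : RootedTree V} (hT : T.root = r) (hT' : T'.root = r) {D D' : Set V}
    (h : ∀ i k, T.Marks D i k ↔ T'.Marks D' i k) (g : FundamentalGroup Y y₀) :
    markHom T hT D g = markHom T' hT' D' g := by
  classical
  induction g using Path.Homotopic.Quotient.ind with | mk γ => ?_
  have hc : ∀ t, treeMap y₀ T hT (fun e => if e.1 ∈ D then γ t else y₀) =
      treeMap y₀ T' hT' (fun e => if e.1 ∈ D' then γ t else y₀) := by
    intro t
    refine BCactRoot.ext fun i k => ?_
    simp only [coord_treeMap_ite, h]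
  let p : Path (BCactRoot.base y₀ r) (BCactRoot.base y₀ r) :=
    { toFun := fun t => treeMap y₀ T hT (fun e => if e.1 ∈ D then γ t else y₀)
      continuous_toFun := by
        refine (treeMap y₀ T hT).continuous.comp (continuous_pi fun e => ?_)
        split_ifs
        · exact γ.continuous
        · exact continuous_const
      source' := by simp [treeMap_base]
      target' := by simp [treeMap_base] }
  have hp : ∀ t i k, (T.Marks D i k → coord i k (p t).1 = γ t) ∧
      (¬ T.Marks D i k → coord i k (p t).1 = y₀) := by
    intro t i k
    have : coord i k (p t).1 = if T.Marks D i k then γ t else y₀ := coord_treeMap_ite T hT D _ i k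
    rw [this]
    exact ⟨fun h => if_pos h, fun h => if_neg h⟩
  rw [markHom_mk T hT D γ p hp, markHom_mk T' hT' D' γ p]
  simpa only [h] using hp

theorem commute_markHom (T : RootedTree V) (hT : T.root = r) {D D' : Set V} (hD : Disjoint D D')
    (g h : FundamentalGroup Y y₀) : Commute (markHom T hT D g) (markHom T hT D' h) := by
  refine Commute.map ?_ (treeHom y₀ T hT)
  refine Pi.commute_iff.2 fun e => ?_
  by_cases h1 : e.1 ∈ D
  · rw [if_neg (Set.disjoint_left.1 hD h1)]
    exact Commute.one_right _
  · rw [if_neg h1]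
    exact Commute.one_left _

theorem markHom_union (T : RootedTree V) (hT : T.root = r) {D D' : Set V} (hD : Disjoint D D')
    (g : FundamentalGroup Y y₀) :
    markHom T hT (D ∪ D') g = markHom T hT D g * markHom T hT D' g := by
  rw [markHom, markHom, markHom, ← map_mul]
  congr 1
  funext e
  rw [Pi.mul_apply]
  by_cases h1 : e.1 ∈ D
  · rw [if_pos (Set.mem_union_left D' h1), if_pos h1, if_neg (Set.disjoint_left.1 hD h1), mul_one]
  · have : e.1 ∈ D ∪ D' ↔ e.1 ∈ D' := by simp [h1]
    rw [if_neg h1, one_mul]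
    by_cases h2 : e.1 ∈ D'
    · rw [if_pos h2, if_pos (this.2 h2)]
    · rw [if_neg h2, if_neg (mt this.1 h2)]

theorem alpha_eq_markHom (i j : V) (hij : i ≠ j) (hj : j ≠ r) (g : FundamentalGroup Y y₀)
    {T : RootedTree V} (hT : T.root = r) {D : Set V}
    (h : ∀ i' k, T.Marks D i' k ↔ i' = i ∧ k = j) :
    alpha y₀ r i j hij hj g = markHom T hT D g := by
  induction g using Path.Homotopic.Quotient.ind with | mk γ => ?_
  refine (alpha_mk hij hj γ).trans (markHom_mk T hT D γ _ fun t i' k => ?_).symm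
  have hc := coord_branchMap (y₀ := y₀) hij hj (γ t) i' k
  rw [h]
  exact ⟨fun h => hc.trans (if_pos h), fun h => hc.trans (if_neg h)⟩

theorem treeHom_mem {H : Subgroup (FundamentalGroup (BCactRoot y₀ r) (BCactRoot.base y₀ r))}
    (hH : ∀ i j hij hj g, alpha y₀ r i j hij hj g ∈ H) (T : RootedTree V) (hT : T.root = r)
    (x : T.Edge → FundamentalGroup Y y₀) : treeHom y₀ T hT x ∈ H := by
  classical
  -- In a star the edges ending in `D` end in leaves, so moving one of them is exactly an element α.
  have hstar : ∀ (i : V) (D : Set V) (hi : i ∉ D) (hr : r ∉ D) (g : FundamentalGroup Y y₀),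
      markHom (RootedTree.star r i D hi hr) (RootedTree.root_star hi hr) D g ∈ H := by
    intro i D hi hr g
    rw [markHom, ← Subgroup.mem_comap]
    refine Subgroup.pi_mem_of_mulSingle_mem _ fun e => ?_
    rw [Subgroup.mem_comap]
    split_ifs with he
    · have her : e.1 ≠ r := e.2
      have : markHom (RootedTree.star r i D hi hr) (RootedTree.root_star hi hr) {e.1} g ∈ H := by
        rw [← alpha_eq_markHom i e.1 (fun h => hi (h ▸ he)) her g (RootedTree.root_star hi hr)]
        · exact hH ..
        · intro i' k
          rw [RootedTree.marks_star hi hr (by simpa using he), Set.mem_singleton_iff]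
      convert this
      rw [markHom]
      congr 1
      funext e'
      simp [Pi.mulSingle_apply, Subtype.ext_iff]
    · rw [Pi.mulSingle_one, map_one]
      exact H.one_mem
  rw [← Subgroup.mem_comap]
  refine Subgroup.pi_mem_of_mulSingle_mem _ fun e => ?_
  rw [Subgroup.mem_comap]
  have h1 : treeHom y₀ T hT (Pi.mulSingle e (x e)) = markHom T hT {e.1} (x e) := by
    rw [markHom]
    congr 1
    funext e'
    simp [Pi.mulSingle_apply, Subtype.ext_iff]
  -- `D` consists of the end of `e` and all its descendants. Moving the label of `e` changes the
  -- coordinates from `T.parent e.1` to each of them, as does moving all edges from that vertex to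
  -- `D` in a star.
  let D : Set V := {k | T.toward (T.parent e.1) k = some e}
  have hi : T.parent e.1 ∉ D := by simp [D, RootedTree.toward_self]
  have hr : r ∉ D := by simp [D, ← hT]
  rw [h1, markHom_congr hT (RootedTree.root_star hi hr) (T' := RootedTree.star r (T.parent e.1) D hi hr) (D' := D)]
  · exact hstar ..
  · intro i k
    rw [RootedTree.marks_star hi hr subset_rfl]
    constructor
    · rintro ⟨e', he', h⟩
      obtain rfl : e' = e := Subtype.ext h
      obtain rfl := RootedTree.parent_of_toward he'
      exact ⟨rfl, he'⟩
    · rintro ⟨rfl, h⟩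
      exact ⟨e, h, rfl⟩

/-- Both loops live on one tree with edges i → j and k → l and move different edges. The case `k =
i` is allowed, which covers two of the relations; `j ≠ k` ensures that moving i → j does not affect
the coordinate at `l`. -/
theorem commute_alpha {i j k l : V} (hij : i ≠ j) (hil : i ≠ l) (hkl : k ≠ l) (hjk : j ≠ k)
    (hjl : j ≠ l) (hj : j ≠ r) (hl : l ≠ r) (g h : FundamentalGroup Y y₀) :
    Commute (alpha y₀ r i j hij hj g) (alpha y₀ r k l hkl hl h) := by
  have hT : (RootedTree.twoBranch r i j k l hij hil hkl hj hl).root = r := rfl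
  rw [alpha_eq_markHom i j hij hj g hT (D := {j}), alpha_eq_markHom k l hkl hl h hT (D := {l})]
  · exact commute_markHom _ _ (by simpa using hjl) g h
  · intro i' m
    rw [RootedTree.marks_twoBranch hij hil hkl hjl hj hl (by simp)]
    simp [hjl, and_comm]
  · intro i' m
    rw [RootedTree.marks_twoBranch hij hil hkl hjl hj hl (by simp)]
    simp [hjl.symm, hjk.symm, and_comm]

/-- In the tree i → j → k the product is the loop moving only the first edge, and the other element
moves only the second. The product itself is computed in the tree with edges i → j and i → k. -/
theorem commute_alpha_mul_alpha {i j k : V} (hij : i ≠ j) (hik : i ≠ k) (hjk : j ≠ k)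
    (hj : j ≠ r) (hk : k ≠ r) (g h : FundamentalGroup Y y₀) :
    Commute (alpha y₀ r i j hij hj g * alpha y₀ r i k hik hk g) (alpha y₀ r j k hjk hk h) := by
  have hT : (RootedTree.twoBranch r i j j k hij hik hjk hj hk).root = r := rfl
  have hT' : (RootedTree.twoBranch r i j i k hij hik hik hj hk).root = r := rfl
  have h1 : alpha y₀ r i j hij hj g * alpha y₀ r i k hik hk g = markHom _ hT {j} g := by
    rw [alpha_eq_markHom i j hij hj g hT' (D := {j}), alpha_eq_markHom i k hik hk g hT' (D := {k}),
      ← markHom_union _ _ (by simpa using hjk)]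
    · refine markHom_congr _ _ (fun i' m => ?_) g
      rw [RootedTree.marks_twoBranch hij hik hik hjk hj hk (by rintro a (h | h) <;> simp_all),
        RootedTree.marks_twoBranch hij hik hjk hjk hj hk (by simp)]
      simp [hjk.symm, hij]
    · intro i' m
      rw [RootedTree.marks_twoBranch hij hik hik hjk hj hk (by simp)]
      simp [hjk, and_comm]
    · intro i' m
      rw [RootedTree.marks_twoBranch hij hik hik hjk hj hk (by simp)]
      simp [hjk.symm, hij, and_comm]
  rw [h1, alpha_eq_markHom j k hjk hk h hT (D := {k})]
  · exact commute_markHom _ _ (by simpa using hjk) g h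
  · intro i' m
    rw [RootedTree.marks_twoBranch hij hik hjk hjk hj hk (by simp)]
    simp [hjk, and_comm]

end TreeMap

/-! ### Deformations of the space of based cacti -/

section Deform

variable {V : Type u} [DecidableEq V] {Y : Type v} [TopologicalSpace Y] {y₀ : Y} {r : V}

/-- The homotopy of the space of based cacti induced by a based homotopy of the label space. -/
def deform (h : C(Y × I, Y)) (h₀ : ∀ t, h (y₀, t) = y₀) : C(BCact V y₀, C(I, BCact V y₀)) where
  toFun := Quot.lift
    (fun x => ⟨fun t => Quot.mk _ ⟨x.1, fun e => h (x.2 e, t)⟩,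
      continuous_quot_mk.comp (continuous_sigmaMk.comp (by fun_prop))⟩) (by
      rintro _ _ ⟨T, l, j, hj, hi, hl⟩
      ext t
      refine (Quot.sound (IsReduction.mk T (fun e => h (l e, t)) j hj hi (by rw [hl, h₀]))).trans ?_
      simp only
      congr 2
      funext e
      split_ifs <;> rfl)
  continuous_toFun := by
    refine continuous_quot_lift _ (continuous_sigma fun T => ?_)
    let g : C((T.Edge → Y) × I, BCact V y₀) :=
      ⟨fun p => Quot.mk _ ⟨T, fun e => h (p.1 e, p.2)⟩,
        continuous_quot_mk.comp (continuous_sigmaMk.comp (by fun_prop))⟩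
    -- With values in `C(I, BCact V y₀)` the map descends to the quotient directly, which avoids
    -- asking whether the quotient map times `I` is a quotient map.
    exact g.curry.continuous

theorem root_deform (h : C(Y × I, Y)) (h₀ : ∀ t, h (y₀, t) = y₀) (x : BCact V y₀) (t : I) :
    (deform h h₀ x t).root = x.root := by
  induction x using Quot.ind with | mk x => rfl

theorem coord_deform (h : C(Y × I, Y)) (h₀ : ∀ t, h (y₀, t) = y₀) (x : BCact V y₀) (t : I)
    (i k : V) : coord i k (deform h h₀ x t) = h (coord i k x, t) := by
  induction x using Quot.ind with | mk x => ?_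
  change (x.1.toward i k).elim y₀ (fun e => h (x.2 e, t)) = h ((x.1.toward i k).elim y₀ x.2, t)
  cases x.1.toward i k with
  | none => exact (h₀ t).symm
  | some e => rfl

/-- The homotopy `deform` on based cacti with a given root. -/
def deformRoot (h : C(Y × I, Y)) (h₀ : ∀ t, h (y₀, t) = y₀) :
    C(BCactRoot y₀ r × I, BCactRoot y₀ r) where
  toFun p := ⟨deform h h₀ p.1.1 p.2, (root_deform h h₀ _ _).trans p.1.2⟩
  continuous_toFun := by
    have : Continuous fun p : BCactRoot y₀ r × I => deform h h₀ p.1.1 p.2 :=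
      ((deform h h₀).continuous.comp (continuous_subtype_val.comp continuous_fst)).eval
        continuous_snd
    exact this.subtype_mk _

theorem coord_deformRoot (h : C(Y × I, Y)) (h₀ : ∀ t, h (y₀, t) = y₀) (x : BCactRoot y₀ r) (t : I)
    (i k : V) : coord i k (deformRoot h h₀ (x, t)).1 = h (coord i k x.1, t) :=
  coord_deform h h₀ x.1 t i k

/-- The label of the edge leaving `i` towards `k` as a continuous map. -/
def coordMap (y₀ : Y) (r i k : V) : C(BCactRoot y₀ r, Y) :=
  ⟨fun x => coord i k x.1, (continuous_coord i k).comp continuous_subtype_val⟩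

end Deform

/-- A homotopy that starts with the identity and is constant in time at the base point of a loop does
not change the class of the loop. -/
theorem freeClass_homotopy {Z : Type*} [TopologicalSpace Z] {z₀ : Z} (C : ∀ z, Path z₀ z)
    (K : C(Z × I, Z)) (hK : ∀ z, K (z, 0) = z) {γ : C(I, Z)} {a : Z} (h0 : γ 0 = a) (h1 : γ 1 = a)
    (ha : ∀ t, K (a, t) = a) :
    freeClass C ((K.comp ((ContinuousMap.id Z).prodMk (.const Z 1))).comp γ) = freeClass C γ := by
  have hs := (multiplicativeOn_freeClass C).square
    (K.comp (γ.prodMap (.id I))) fun _ => trivial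
  have e1 : (K.comp (γ.prodMap (.id I))).comp rightSide = .const I a := by
    ext t
    simp [rightSide, h1, ha]
  have e2 : (K.comp (γ.prodMap (.id I))).comp leftSide = .const I a := by
    ext t
    simp [leftSide, h0, ha]
  have e3 : (K.comp (γ.prodMap (.id I))).comp bottomSide = γ := by
    ext t
    simp [bottomSide, hK]
  have e4 : (K.comp (γ.prodMap (.id I))).comp topSide =
      (K.comp ((ContinuousMap.id Z).prodMk (.const Z 1))).comp γ := by
    ext t
    simp [topSide]
  rw [e1, e2, e3, e4, freeClass_const, one_mul, mul_one] at hs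
  exact hs.symm

/-! ### An open cover of the space of based cacti -/

section Cover

variable {V : Type u} [DecidableEq V] {Y : Type v} [TopologicalSpace Y] {y₀ : Y} {r : V}

/-- The based cacti such that labels that do not occur in labellings of `T` are close to the base
point, and labels of edges of `T` away from the root are different from the base point. -/
def treeNhd (w : C(Y, I)) (T : RootedTree V) : Set (BCactRoot y₀ r) :=
  {x | ∀ i k, (T.toward i k = none → w (coord i k x.1) < 1) ∧
    (T.toward i k ≠ none → i ≠ r → coord i k x.1 ≠ y₀)}

/-- Being different from `y₀` is the open condition `w ≠ 0`, and finitely many open conditions are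
imposed. -/
theorem isOpen_treeNhd [Fintype V] {w : C(Y, I)} (hw : ∀ y, w y = 0 ↔ y = y₀) (T : RootedTree V) :
    IsOpen (treeNhd w T : Set (BCactRoot y₀ r)) := by
  have hc : ∀ i k, Continuous fun x : BCactRoot y₀ r => w (coord i k x.1) :=
    fun i k => w.continuous.comp (coordMap y₀ r i k).continuous
  simp only [treeNhd, Set.ofPred_forall, Set.ofPred_and]
  refine isOpen_iInter_of_finite fun i => isOpen_iInter_of_finite fun k => ?_
  refine IsOpen.inter (isOpen_iInter_of_finite fun _ => isOpen_lt (hc i k) continuous_const)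
    (isOpen_iInter_of_finite fun _ => isOpen_iInter_of_finite fun _ => ?_)
  simp only [ne_eq, ← hw]
  exact isOpen_ne_fun (hc i k) continuous_const

/-- The tree of a reduced representative works. -/
theorem exists_mem_treeNhd [Fintype V] {w : C(Y, I)} (hw : ∀ y, w y = 0 ↔ y = y₀)
    (x : BCactRoot y₀ r) : ∃ T : {T : RootedTree V // T.root = r}, x ∈ treeNhd w T.1 := by
  obtain ⟨x, hx⟩ := x
  induction x using Quot.ind with | mk x => ?_
  obtain ⟨z, h1, h2, h3⟩ := exists_isReduced (y₀ := y₀) x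
  refine ⟨⟨z.1, h1.trans hx⟩, fun i k => ?_⟩
  have hc : coord i k (Quot.mk _ x : BCact V y₀) = treeCoord y₀ i k z := by
    rw [← h3]
    rfl
  constructor
  · intro h
    change w (coord i k (Quot.mk _ x)) < 1
    rw [hc, treeCoord, h, Option.elim_none, (hw y₀).2 rfl]
    exact zero_lt_one
  · intro h hi
    change coord i k (Quot.mk _ x) ≠ y₀
    rw [hc]
    exact h2.treeCoord_ne h (by rwa [h1.trans hx])

/-- Let `S` be a tree representing `x`. If `e.1 ≠ k`, the nonvanishing conditions force `e.1` to lie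
above `k` in `S`, and `i`, unless it is the root, to lie above `e.1`. So in `S` the paths from `i`
to `k` and to `e.1` start with the same edge. -/
theorem coord_eq_of_mem_treeNhd {w : C(Y, I)} {T : RootedTree V} (hT : T.root = r)
    {x : BCactRoot y₀ r} (hx : x ∈ treeNhd w T) {i k : V} {e : T.Edge}
    (he : T.toward i k = some e) : coord i k x.1 = coord i e.1 x.1 := by
  rcases RootedTree.toward_of_toward he with h | h
  · rw [h]
  obtain rfl := RootedTree.parent_of_toward he
  have he' : T.toward (T.parent e.1) e.1 ≠ none := by
    rw [RootedTree.toward_of_parent_eq e.2 rfl]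
    simp
  have hk := (hx e.1 k).2 h (hT ▸ e.2)
  have hi := (hx (T.parent e.1) e.1).2 he'
  have hne : T.parent e.1 ≠ e.1 := fun e' => by
    rw [e'] at he'
    exact he' (RootedTree.toward_self _)
  obtain ⟨S, hS, l, rfl⟩ := exists_treeMap_eq x
  rw [coord_treeMap, coord_treeMap, RootedTree.toward_eq_toward hne]
  · exact toward_ne_none_of_treeCoord (x := ⟨S, l⟩) hk
  · by_cases h1 : T.parent e.1 = r
    · rw [h1, ← hS]
      exact RootedTree.toward_root _ _
    · exact RootedTree.toward_eq_none_of_depth_le (RootedTree.depth_lt_of_toward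
        (toward_ne_none_of_treeCoord (x := ⟨S, l⟩) (hi h1))).le

/-- Although `x` need not be a labelling of `T`, its coordinates after applying `f` are those of
one. -/
theorem map_coord_of_mem_treeNhd {w : C(Y, I)} {T : RootedTree V} (hT : T.root = r)
    {x : BCactRoot y₀ r} (hx : x ∈ treeNhd w T) {f : Y → Y} (hf : ∀ y, w y < 1 → f y = y₀)
    (i k : V) : f (coord i k x.1) =
      (T.toward i k).elim y₀ fun e => f (coord (T.parent e.1) e.1 x.1) := by
  cases he : T.toward i k with
  | none => exact hf _ ((hx i k).1 he)
  | some e => rw [coord_eq_of_mem_treeNhd hT hx he, Option.elim_some,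
      RootedTree.parent_of_toward he]

end Cover

/-! ### The fundamental group -/

section Main

variable {V : Type u} [DecidableEq V] {Y : Type v} [TopologicalSpace Y] {y₀ : Y} {r : V}

/-- The array of the classes of the coordinates of a path of based cacti, moved by a self-map of the
label space. -/
noncomputable def coordClass (c : ∀ y, Path y₀ y) (f : C(Y, Y)) (γ : C(I, BCactRoot y₀ r))
    (i k : V) : FundamentalGroup Y y₀ :=
  freeClass c ((f.comp (coordMap y₀ r i k)).comp γ)

theorem coordClass_path (c : ∀ y, Path y₀ y) (f : C(Y, Y)) (γ : C(I, BCactRoot y₀ r)) :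
    coordClass c f γ = coordClass c f (γ.comp rightHalf) * coordClass c f (γ.comp leftHalf) := by
  funext i k
  exact freeClass_path c _

theorem coordClass_square (c : ∀ y, Path y₀ y) (f : C(Y, Y)) (s : C(I × I, BCactRoot y₀ r)) :
    coordClass c f (s.comp rightSide) * coordClass c f (s.comp bottomSide) =
      coordClass c f (s.comp topSide) * coordClass c f (s.comp leftSide) := by
  funext i k
  exact (multiplicativeOn_freeClass c).square ((f.comp (coordMap y₀ r i k)).comp s)
    fun _ => trivial

theorem coordClass_const (c : ∀ y, Path y₀ y) (f : C(Y, Y)) (x : BCactRoot y₀ r) :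
    coordClass c f (.const I x) = 1 := by
  funext i k
  exact freeClass_const c (f (coord i k x.1))

theorem coordClass_of_mem_treeNhd (c : ∀ y, Path y₀ y) {f : C(Y, Y)} {w : C(Y, I)}
    (hf : ∀ y, w y < 1 → f y = y₀) {T : RootedTree V} (hT : T.root = r)
    {γ : C(I, BCactRoot y₀ r)} (hγ : ∀ t, γ t ∈ treeNhd w T) :
    coordClass c f γ = treeArray T fun e => coordClass c f γ (T.parent e.1) e.1 := by
  funext i k
  have hm := fun t => map_coord_of_mem_treeNhd hT (hγ t) (f := f) hf i k
  rw [treeArray]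
  cases he : T.toward i k with
  | none =>
    simp only [he, Option.elim_none] at hm
    have : (f.comp (coordMap y₀ r i k)).comp γ = .const I y₀ := ContinuousMap.ext hm
    rw [coordClass, this, freeClass_const, Option.elim_none]
  | some e =>
    simp only [he, Option.elim_some] at hm
    have : (f.comp (coordMap y₀ r i k)).comp γ =
      (f.comp (coordMap y₀ r (T.parent e.1) e.1)).comp γ := ContinuousMap.ext hm
    rw [coordClass, this, Option.elim_some, coordClass]

theorem coordClass_branchMap (c : ∀ y, Path y₀ y) (f : C(Y, Y)) (hf : f y₀ = y₀) {i j : V}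
    (hij : i ≠ j) (hj : j ≠ r) (γ : C(I, Y)) :
    coordClass c f ((branchMap y₀ r i j hij hj).comp γ) =
      (Pi.mulSingle i (Pi.mulSingle j (freeClass c (f.comp γ))) :
        V → V → FundamentalGroup Y y₀) := by
  funext i' k
  have hcoord : ∀ t, ((f.comp (coordMap y₀ r i' k)).comp ((branchMap y₀ r i j hij hj).comp γ)) t
      = f (if i' = i ∧ k = j then γ t else y₀) :=
    fun t => congr_arg f (coord_branchMap hij hj (γ t) i' k)
  by_cases hik : i' = i ∧ k = j
  · simp only [hik, and_self, if_true] at hcoord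
    obtain ⟨rfl, rfl⟩ := hik
    rw [Pi.mulSingle_eq_same, Pi.mulSingle_eq_same]
    exact congr_arg (freeClass c) (ContinuousMap.ext hcoord)
  · simp only [hik, if_false, hf] at hcoord
    rw [coordClass, show _ = ContinuousMap.const I y₀ from ContinuousMap.ext hcoord,
      freeClass_const]
    by_cases hi : i' = i
    · subst hi
      rw [Pi.mulSingle_eq_same, Pi.mulSingle_eq_of_ne fun hk => hik ⟨rfl, hk⟩]
    · rw [Pi.mulSingle_eq_of_ne hi, Pi.one_apply]

variable [Fintype V]

theorem treeMap_coord_of_mem_treeNhd {w : C(Y, I)} {T : RootedTree V} (hT : T.root = r)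
    {x : BCactRoot y₀ r} (hx : x ∈ treeNhd w T) (h : C(Y × I, Y)) (h₀ : ∀ t, h (y₀, t) = y₀)
    (h₁ : ∀ y, w y < 1 → h (y, 1) = y₀) :
    deformRoot h h₀ (x, 1) =
      treeMap y₀ T hT fun e => h (coord (T.parent e.1) e.1 x.1, 1) := by
  refine BCactRoot.ext fun i k => ?_
  rw [coord_deformRoot, coord_treeMap]
  exact map_coord_of_mem_treeNhd hT hx (f := fun y => h (y, 1)) h₁ i k

/-- The element of the fundamental group that corresponds to a generator. -/
noncomputable def alphaGen (y₀ : Y) (r : V) (x : Gen r (FundamentalGroup Y y₀)) :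
    FundamentalGroup (BCactRoot y₀ r) (BCactRoot.base y₀ r) :=
  alpha y₀ r x.src x.tgt x.src_ne_tgt x.tgt_ne_root x.label

/-- The elements `α_{ij}^g` satisfy the relations of the presentation. -/
theorem lift_alphaGen_eq_one (y₀ : Y) (r : V) (w : FreeGroup (Gen r (FundamentalGroup Y y₀)))
    (hw : w ∈ {w | IsRelator r (FundamentalGroup Y y₀) w}) :
    FreeGroup.lift (alphaGen y₀ r) w = 1 := by
  cases hw with
  | mul i j hij hj g h =>
    simp only [map_mul, map_inv, gen, FreeGroup.lift_apply_of, mul_inv_eq_one]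
    exact (map_mul (FundamentalGroup.mapOfEq (branchMap y₀ r i j hij hj)
      (branchMap_base y₀ r i j hij hj)) g h).symm
  | comm_same i j k hij hik hjk hj hk g h =>
    simp only [map_commutatorElement, gen, FreeGroup.lift_apply_of,
      commutatorElement_eq_one_iff_commute]
    exact commute_alpha hij hik hik hij.symm hjk hj hk g h
  | comm_disjoint i j k l hij hik hil hjk hjl hkl hj hl g h =>
    simp only [map_commutatorElement, gen, FreeGroup.lift_apply_of,
      commutatorElement_eq_one_iff_commute]
    exact commute_alpha hij hil hkl hjk hjl hj hl g h
  | comm_triple i j k hij hik hjk hj hk g h =>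
    simp only [map_commutatorElement, map_mul, gen, FreeGroup.lift_apply_of,
      commutatorElement_eq_one_iff_commute]
    exact commute_alpha_mul_alpha hij hik hjk hj hk g h

/-- The homomorphism from the presented group to the fundamental group. -/
noncomputable def cactusHom (y₀ : Y) (r : V) : CactusGroup r (FundamentalGroup Y y₀) →*
    FundamentalGroup (BCactRoot y₀ r) (BCactRoot.base y₀ r) :=
  PresentedGroup.toGroup (lift_alphaGen_eq_one y₀ r)

theorem cactusHom_of (i j : V) (hij : i ≠ j) (hj : j ≠ r) (g : FundamentalGroup Y y₀) :
    cactusHom y₀ r (PresentedGroup.of ⟨i, j, hij, hj, g⟩) = alpha y₀ r i j hij hj g :=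
  PresentedGroup.toGroup.of _

/-- All labels of a representative move along `c` at once. The normalization `hc` keeps trivial
coordinates trivial, so the path is described by coordinates, independently of the representative.
-/
theorem exists_path_from_base (c : ∀ y, Path y₀ y) (hc : c y₀ = Path.refl y₀)
    (x : BCactRoot y₀ r) : ∃ p : Path (BCactRoot.base y₀ r) x,
      ∀ t i k, coord i k (p t).1 = c (coord i k x.1) t := by
  obtain ⟨T, hT, l, rfl⟩ := exists_treeMap_eq x
  refine ⟨⟨⟨fun t => treeMap y₀ T hT fun e => c (l e) t, by fun_prop⟩, ?_, ?_⟩, fun t i k => ?_⟩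
  · simp [treeMap_base]
  · simp
  · change coord i k (treeMap y₀ T hT fun e => c (l e) t).1 = _
    rw [coord_treeMap, coord_treeMap]
    cases T.toward i k with
    | none =>
      change y₀ = c y₀ t
      rw [hc]
      rfl
    | some e => rfl

theorem exists_based_paths [PathConnectedSpace Y] (y₀ : Y) :
    ∃ c : ∀ y, Path y₀ y, c y₀ = Path.refl y₀ := by
  classical
  refine ⟨fun y => if h : y₀ = y then (Path.refl y₀).cast rfl h.symm
    else PathConnectedSpace.somePath y₀ y, ?_⟩
  exact (dif_pos rfl).trans rfl

theorem arrayProd_coordClass_mul (c : ∀ y, Path y₀ y) {f : C(Y, Y)} {w : C(Y, I)}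
    (hf : ∀ y, w y < 1 → f y = y₀) {T : RootedTree V} (hT : T.root = r)
    {γ δ : C(I, BCactRoot y₀ r)} (hγ : ∀ t, γ t ∈ treeNhd w T) (hδ : ∀ t, δ t ∈ treeNhd w T) :
    arrayProd r (coordClass c f γ) * arrayProd r (coordClass c f δ) =
      arrayProd r (coordClass c f γ * coordClass c f δ) := by
  rw [coordClass_of_mem_treeNhd c hf hT hγ, coordClass_of_mem_treeNhd c hf hT hδ,
    ← arrayProd_treeArray_mul hT]
  congr 1
  funext i k
  simp only [treeArray, Pi.mul_apply]
  cases T.toward i k <;> simp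

/-- The arrays of classes satisfy both identities entrywise in G, for all paths and squares. On
`treeNhd w T` they are arrays of the one tree `T`, where passing to `arrayProd` preserves products.
-/
theorem multiplicativeOn_treeNhd (c : ∀ y, Path y₀ y) {f : C(Y, Y)} {w : C(Y, I)}
    (hf : ∀ y, w y < 1 → f y = y₀) {T : RootedTree V} (hT : T.root = r) :
    MultiplicativeOn (fun γ : C(I, BCactRoot y₀ r) => arrayProd r (coordClass c f γ))
      (treeNhd w T) where
  path γ hγ := by
    rw [coordClass_path]
    exact (arrayProd_coordClass_mul c hf hT (γ := γ.comp rightHalf) (δ := γ.comp leftHalf)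
      (fun t => hγ _) (fun t => hγ _)).symm
  square s hs := by
    refine (arrayProd_coordClass_mul c hf hT (γ := s.comp rightSide) (δ := s.comp bottomSide)
      (fun t => hs _) (fun t => hs _)).trans ?_
    rw [coordClass_square]
    exact (arrayProd_coordClass_mul c hf hT (γ := s.comp topSide) (δ := s.comp leftSide)
      (fun t => hs _) (fun t => hs _)).symm

theorem develop_branchMap (c : ∀ y, Path y₀ y) (f : C(Y, Y)) (hf : f y₀ = y₀) {i j : V}
    (hij : i ≠ j) (hj : j ≠ r) (m : ℕ) (γ : C(I, Y)) :
    develop (fun γ : C(I, BCactRoot y₀ r) => arrayProd r (coordClass c f γ)) m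
      ((branchMap y₀ r i j hij hj).comp γ) = genHom r i j (freeClass c (f.comp γ)) := by
  induction m generalizing γ with
  | zero => rw [develop, coordClass_branchMap c f hf, arrayProd_single]
  | succ m ih =>
    rw [develop, ContinuousMap.comp_assoc, ContinuousMap.comp_assoc, ih, ih, ← map_mul,
      freeClass_path c (f.comp γ)]
    rfl

/-- There is a homomorphism from the fundamental group to the presented group that sends the
elements `α_{ij}^g` to the generators. -/
theorem exists_holonomy_alpha [PathConnectedSpace Y] (hY : WellPointed y₀) :
    ∃ ψ : FundamentalGroup (BCactRoot y₀ r) (BCactRoot.base y₀ r) →*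
        CactusGroup r (FundamentalGroup Y y₀),
      ∀ (i j : V) (hij : i ≠ j) (hj : j ≠ r) (g : FundamentalGroup Y y₀),
        ψ (alpha y₀ r i j hij hj g) = PresentedGroup.of ⟨i, j, hij, hj, g⟩ := by
  obtain ⟨w, h, hw, hid, h₀, h₁⟩ := hY
  obtain ⟨c, hc⟩ := exists_based_paths y₀
  let f : C(Y, Y) := h.comp ((ContinuousMap.id Y).prodMk (.const Y 1))
  obtain ⟨ψ, hψ⟩ := exists_holonomy
    (fun T : {T : RootedTree V // T.root = r} => isOpen_treeNhd hw T.1) (exists_mem_treeNhd hw)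
    (fun T => multiplicativeOn_treeNhd c (f := f) h₁ T.2)
    (fun x => by rw [coordClass_const, arrayProd_one]) (BCactRoot.base y₀ r)
  refine ⟨ψ, fun i j hij hj g => ?_⟩
  induction g using Path.Homotopic.Quotient.ind with | mk γ => ?_
  obtain ⟨m, hm⟩ := (hψ (branchLoop hij hj γ)).exists
  -- On a branch loop the subdivided product has the same value at every depth, so it gives the
  -- value of `ψ`.
  have hdev := develop_branchMap c f (h₀ 1) hij hj m γ.toContinuousMap
  have hcl : freeClass c (f.comp γ.toContinuousMap) =
      FundamentalGroup.fromPath (Path.Homotopic.Quotient.mk γ) :=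
    (freeClass_homotopy c h hid γ.source γ.target h₀).trans
      ((freeClass_toContinuousMap c γ).trans (basedClass_loop c hc γ))
  rw [hcl, genHom_apply hij hj] at hdev
  exact (congr_arg ψ (alpha_mk hij hj γ)).trans (hm.symm.trans hdev)

/-- The fundamental group is generated by the elements `α_{ij}^g`. -/
theorem mem_of_alpha_mem [PathConnectedSpace Y] (hY : WellPointed y₀)
    {H : Subgroup (FundamentalGroup (BCactRoot y₀ r) (BCactRoot.base y₀ r))}
    (hH : ∀ i j hij hj g, alpha y₀ r i j hij hj g ∈ H)
    (x : FundamentalGroup (BCactRoot y₀ r) (BCactRoot.base y₀ r)) : x ∈ H := by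
  obtain ⟨w, h, hw, hid, h₀, h₁⟩ := hY
  obtain ⟨c, hc⟩ := exists_based_paths y₀
  choose C hC using exists_path_from_base (r := r) c hc
  have hCbase : C (BCactRoot.base y₀ r) = Path.refl _ := by
    ext t
    refine BCactRoot.ext fun i k => ?_
    rw [hC, coord_base, hc]
    simp [coord_base]
  have htree : ∀ (T : RootedTree V) (hT : T.root = r) (γ : C(I, BCactRoot y₀ r))
      (l : T.Edge → C(I, Y)), (∀ t, γ t = treeMap y₀ T hT fun e => l e t) →
      freeClass C γ ∈ H := by
    intro T hT γ l hγ
    -- The paths closing up `γ` are also labellings of `T`, so the resulting loop lies in the image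
    -- of `treeMap`.
    have hCt : ∀ s t, C (γ s) t = treeMap y₀ T hT fun e => c (l e s) t := by
      intro s t
      refine BCactRoot.ext fun i k => ?_
      rw [hC, hγ, coord_treeMap, coord_treeMap]
      cases T.toward i k with
      | none =>
        change c y₀ t = y₀
        rw [hc]
        rfl
      | some e => rfl
    have := treeHom_mk T hT (fun e => ((c (l e 0)).trans ⟨l e, rfl, rfl⟩).trans (c (l e 1)).symm)
      (((C (γ 0)).trans ⟨γ, rfl, rfl⟩).trans (C (γ 1)).symm) (fun t => by
        simp only [Path.trans_apply]
        split_ifs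
        · exact hCt _ _
        · exact hγ _
        · exact hCt _ _)
    have key : freeClass C γ = treeHom y₀ T hT fun e => freeClass c (l e) := this.symm
    rw [key]
    exact treeHom_mem hH T hT _
  let R : C(BCactRoot y₀ r, BCactRoot y₀ r) :=
    (deformRoot h h₀).comp ((ContinuousMap.id _).prodMk (.const _ 1))
  -- Locally `R` lands in labellings of one tree, where `htree` applies; subdivision reduces every
  -- path to such pieces. Since `R` is homotopic to the identity rel base point, this covers every
  -- loop.
  have hR : ∀ γ : C(I, BCactRoot y₀ r), freeClass C (R.comp γ) ∈ H := by
    refine subdivision_induction half lipschitzWith_half _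
      (fun T : {T : RootedTree V // T.root = r} => isOpen_treeNhd hw T.1) (exists_mem_treeNhd hw)
      _ (fun γ hγ => ?_) fun γ T hγ => ?_
    · rw [freeClass_path]
      exact H.mul_mem (hγ true) (hγ false)
    · exact htree T.1 T.2 _ (fun e => (h.comp ((ContinuousMap.id Y).prodMk (.const Y 1))).comp
        ((coordMap y₀ r (T.1.parent e.1) e.1).comp γ))
        fun t => treeMap_coord_of_mem_treeNhd T.2 (hγ t) h h₀ h₁
  induction x using Path.Homotopic.Quotient.ind with | mk γ => ?_
  have h1 := hR γ.toContinuousMap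
  rw [freeClass_homotopy C (deformRoot h h₀)
    (fun x => BCactRoot.ext fun i k => by rw [coord_deformRoot, hid]) γ.source γ.target
    (fun t => BCactRoot.ext fun i k => by rw [coord_deformRoot, coord_base, h₀]),
    freeClass_toContinuousMap, basedClass_loop C hCbase] at h1
  exact h1

theorem pathConnectedSpace_bCactRoot [PathConnectedSpace Y] :
    PathConnectedSpace (BCactRoot y₀ r) := by
  obtain ⟨c, hc⟩ := exists_based_paths y₀
  have h : ∀ x : BCactRoot y₀ r, Joined (BCactRoot.base y₀ r) x := fun x =>
    ⟨(exists_path_from_base c hc x).choose⟩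
  exact ⟨⟨BCactRoot.base y₀ r⟩, fun x y => (h x).symm.trans (h y)⟩

theorem bijective_cactusHom [PathConnectedSpace Y] (hY : WellPointed y₀) :
    Function.Bijective (cactusHom y₀ r) := by
  obtain ⟨ψ, hψ⟩ := exists_holonomy_alpha (r := r) hY
  have hid : ψ.comp (cactusHom y₀ r) = MonoidHom.id _ := by
    refine PresentedGroup.ext fun x => ?_
    obtain ⟨i, j, hij, hj, g⟩ := x
    exact (congr_arg ψ (cactusHom_of i j hij hj g)).trans (hψ i j hij hj g)
  refine ⟨Function.LeftInverse.injective (g := ψ) fun x => DFunLike.congr_fun hid x, fun x => ?_⟩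
  exact mem_of_alpha_mem hY (H := (cactusHom y₀ r).range)
    (fun i j hij hj g => ⟨_, cactusHom_of i j hij hj g⟩) x

end Main

end BasedCacti

theorem mainTheorem7 {Y : Type*} [TopologicalSpace Y] [PathConnectedSpace Y] (y₀ : Y)
    (hY : BasedCacti.WellPointed y₀) (n : ℕ) [NeZero n] :
    PathConnectedSpace (BasedCacti.BCactRoot y₀ (0 : Fin n)) ∧
    ∃ φ : BasedCacti.CactusGroup (0 : Fin n) (FundamentalGroup Y y₀) ≃*
        FundamentalGroup (BasedCacti.BCactRoot y₀ (0 : Fin n)) (BasedCacti.BCactRoot.base y₀ 0),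
      ∀ (i j : Fin n) (hij : i ≠ j) (hj : j ≠ 0) (g : FundamentalGroup Y y₀),
        φ (PresentedGroup.of ⟨i, j, hij, hj, g⟩) = BasedCacti.alpha y₀ 0 i j hij hj g :=
  ⟨BasedCacti.pathConnectedSpace_bCactRoot,
    MulEquiv.ofBijective (BasedCacti.cactusHom y₀ 0) (BasedCacti.bijective_cactusHom hY),
    fun i j hij hj g => BasedCacti.cactusHom_of i j hij hj g⟩
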